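/- Let $p$ be an odd prime, $n\ge 1$, and let $\mathcal A_p$ be the algebra of Steenrod $p$th powers (no Bocksteins) acting on $\mathbf P=\mathbb F_p[x_1,\dots,x_n]$. For a sequence $R=(r_1,r_2,\dots)$ of non-negative integers, almost all zero, let $P(R)\in\mathcal A_p$ be the Milnor basis element, dual to $\xi_1^{r_1}\xi_2^{r_2}\cdots$; thus $P(R)f$ is the coefficient of $\xi_1^{r_1}\xi_2^{r_2}\cdots$ in the image of $f$ under the ring homomorphism with $x_i\mapsto\sum_{k\ge0}x_i^{p^k}\xi_k$, $\xi_0=1$. For a sequence $c=(c_1,\dots,c_t)$ of positive integers write $c_i=a_i(p-1)+b_i$ with $a_i\ge 0$ and $1\le b_i\le p-1$; the Milnor spike associated to $c$ is $P(r_1,\dots,r_t)$ with $r_i=(b_i+1)p^{a_i}-1$. For $a\ge0$ and $s\ge0$ write $[x_{a+1},x_{a+2}^p,\dots,x_{a+s}^{p^{s-1}}]$ for the determinant $\det(x_{a+j}^{p^{i-1}})_{1\le i,j\le s}$, and let $w(k)=[x_1,x_2^p,\dots,x_k^{p^{k-1}}]$. For a partition $\mu$ with conjugate $\mu'$ let $w(\mu')=\prod_{j=1}^{\mu_1}w(\mu'_j)$.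 A partition $\lambda=(\lambda_1\ge\lambda_2\ge\cdots)$ is column $q$-regular if $\lambda_i-\lambda_{i+1}\le q-1$ for all $i\ge 1$. Let $\lambda=(\lambda_1,\dots,\lambda_n)$ be a partition with exactly $n$ nonzero parts which is $\mathbf T$-regular, i.e. $\lambda$ is column $p$-regular (with $\lambda_{n+1}=0$) and for every $a\ge1$ there is at most one $i$ with $(a-1)(p-1)<\lambda_i<a(p-1)$. Let $m=\lceil\lambda_1/(p-1)\rceil$; for $1\le j\le m$ let $\lambda_{(j)}$ be the partition whose diagram is the $j$th block of $p-1$ consecutive columns of the diagram of $\lambda$ (the $m$th block may have fewer columns), and let $\gamma_j$ be its number of boxes; $\gamma=(\gamma_1,\dots,\gamma_m)$ is the $\mathbf T$-conjugate of $\lambda$. Put $p(\lambda')=\prod_{j=1}^m w(\lambda_{(j)}')^{p^{j-1}}$ and $\epsilon(\lambda)=\sum_{j=1}^{\lfloor m/2\rfloor}(-1)^{j-1}\gamma_{2j}$. For $1\le k\le\gamma_1$, the $k$th antidiagonal of $\lambda$ is the set of boxes $(i,j)$ (row $i$, column $j$) of the diagram with $j+i(p-1)=k+p-1$. If its lowest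 box is in row $i$ and its highest in row $i-s+1$, let $v_k(\lambda)=[x_{i-s+1},x_{i-s+2}^p,\dots,x_i^{p^{s-1}}]$. Let $v(\lambda)=\prod_{k=1}^{\gamma_1}v_k(\lambda)$, and let $s(\lambda)$ be the monomial (with coefficient $1$) that is highest in left lexicographic order of exponents among those occurring in $v(\lambda)$. **Theorem.** (i) If $P(R)$ is the Milnor spike associated to $(\lambda_2,\dots,\lambda_n)$, then $P(R)s(\lambda)=(-1)^{\epsilon(\lambda)}P(R)v(\lambda)=p(\lambda')$. (ii) If $\lambda=(p-1)\kappa$ with $\kappa$ a column $2$-regular partition, and $P(S)$ is the Milnor spike associated to $(\gamma_2,\dots,\gamma_m)$, then $P(S)w(\lambda')=p(\lambda')$. (iii) If $P(R)$ is the Milnor spike associated to $(\lambda_1,\dots,\lambda_n)$, then $P(R)s(\lambda)=(-1)^{\epsilon(\lambda)}P(R)v(\lambda)=p(\lambda')^p$. If $\lambda=(p-1)\kappa$ with $\kappa$ column $2$-regular, and $P(S)$ is the Milnor spike associated to $(\gamma_1,\dots,\gamma_m)$, then $P(S)w(\lambda')=p(\lambda')^p$. -/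

import Mathlib

open scoped BigOperators

namespace TRegular

/-! ### The Milnor basis and its action on the polynomial algebra `F_p[x_1, …, x_n]`

The algebra `A_p` of Steenrod `p`th powers is the graded dual of Milnor's polynomial Hopf algebra
`F_p[ξ_1, ξ_2, …]`, and the Milnor basis element `P(R)`, `R = (r_1, r_2, …)`, is the element dual
to `ξ^R = ξ_1^{r_1} ξ_2^{r_2} ⋯` with respect to the basis of monomials. The action of `A_p` on
`F_p[x_1, …, x_n]` is given by Milnor's coaction: the ring homomorphism into the completed tensor
product with `F_p[ξ_1, ξ_2, …]` that sends each `x_i` to `∑_{k ≥ 0} x_i^{p^k} ξ_k`, with `ξ_0 = 1`.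
So `P(R) f` is the coefficient of `ξ^R` in the coaction on `f`. In the code the power series
variable `k` is `ξ_{k+1}`, and the polynomial variable `i` is `x_{i+1}`. -/

/-- The series `∑_{k ≥ 0} x^{p^k} ξ_k`, with `ξ_0 = 1`. -/
noncomputable def coactionSeries (p : ℕ) {A : Type*} [CommRing A] (x : A) : MvPowerSeries ℕ A :=
  fun d => (if d = 0 then x else 0) +
    ∑ k ∈ d.support, if d = Finsupp.single k 1 then x ^ p ^ (k + 1) else 0

/-- The coefficients of the coaction series. -/
theorem coeff_coactionSeries (p : ℕ) {A : Type*} [CommRing A] (x : A) (d : ℕ →₀ ℕ) :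
    MvPowerSeries.coeff d (coactionSeries p x) = (if d = 0 then x else 0) +
      ∑ k ∈ d.support, if d = Finsupp.single k 1 then x ^ p ^ (k + 1) else 0 := rfl

/-- Milnor's coaction on `F_p[x_1, …, x_n]`. -/
noncomputable def coaction (p n : ℕ) :
    MvPolynomial (Fin n) (ZMod p) →ₐ[ZMod p] MvPowerSeries ℕ (MvPolynomial (Fin n) (ZMod p)) :=
  MvPolynomial.aeval fun i => coactionSeries p (MvPolynomial.X i)

/-- The action of the Milnor basis element `P(R)` on `F_p[x_1, …, x_n]`. -/
noncomputable def milnorP (p n : ℕ) (R : ℕ →₀ ℕ) :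
    MvPolynomial (Fin n) (ZMod p) →ₗ[ZMod p] MvPolynomial (Fin n) (ZMod p) where
  toFun f := MvPowerSeries.coeff R (coaction p n f)
  map_add' f g := by simp
  map_smul' c f := by
    rw [map_smul, RingHom.id_apply]
    rfl

/-- The Cartan formula for Milnor basis elements. -/
theorem milnorP_mul (p n : ℕ) (R : ℕ →₀ ℕ) (f g : MvPolynomial (Fin n) (ZMod p)) :
    milnorP p n R (f * g) =
      ∑ d ∈ Finset.HasAntidiagonal.antidiagonal R, milnorP p n d.1 f * milnorP p n d.2 g := by
  classical
  change MvPowerSeries.coeff R (coaction p n (f * g)) = _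
  rw [map_mul, MvPowerSeries.coeff_mul]
  rfl

/-- `P(0)` fixes the generators. -/
theorem milnorP_zero_X (p n : ℕ) (i : Fin n) :
    milnorP p n 0 (MvPolynomial.X i) = MvPolynomial.X i := by
  change MvPowerSeries.coeff 0 (coaction p n (MvPolynomial.X i)) = _
  rw [coaction, MvPolynomial.aeval_X, coeff_coactionSeries]
  simp

/-- The element dual to `ξ_{k+1}` sends each generator to its `p^{k+1}`th power. In particular
`P^1 = P(1)` sends `x_i` to `x_i^p`. -/
theorem milnorP_single_X (p n : ℕ) (k : ℕ) (i : Fin n) :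
    milnorP p n (Finsupp.single k 1) (MvPolynomial.X i) = MvPolynomial.X i ^ p ^ (k + 1) := by
  change MvPowerSeries.coeff (Finsupp.single k 1) (coaction p n (MvPolynomial.X i)) = _
  rw [coaction, MvPolynomial.aeval_X, coeff_coactionSeries]
  rw [Finsupp.support_single _ one_ne_zero]
  simp

/-- All other Milnor basis elements vanish on the generators. -/
theorem milnorP_X_eq_zero (p n : ℕ) (R : ℕ →₀ ℕ) (h0 : R ≠ 0)
    (h1 : ∀ k, R ≠ Finsupp.single k 1) (i : Fin n) :
    milnorP p n R (MvPolynomial.X i) = 0 := by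
  change MvPowerSeries.coeff R (coaction p n (MvPolynomial.X i)) = _
  rw [coaction, MvPolynomial.aeval_X, coeff_coactionSeries]
  simp [h0, h1]

/-! ### Partitions

A partition `λ` is a `YoungDiagram`; its boxes have coordinates starting at `0`, so that
`lam.rowLen i` is `λ_{i+1}` and `lam.colLen j` is `λ'_{j+1}`. -/

/-- `λ` is column `q`-regular: `λ_i - λ_{i+1} ≤ q - 1` for all `i`. -/
def ColumnRegular (q : ℕ) (lam : YoungDiagram) : Prop :=
  ∀ i, lam.rowLen i - lam.rowLen (i + 1) ≤ q - 1

/-- `λ` is T-regular: column `p`-regular and, for all `a`, at most one part of `λ` lies strictly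
between `a(p-1)` and `(a+1)(p-1)`. -/
def IsTRegular (p : ℕ) (lam : YoungDiagram) : Prop :=
  ColumnRegular p lam ∧
    ∀ a i j : ℕ,
      a * (p - 1) < lam.rowLen i → lam.rowLen i < (a + 1) * (p - 1) →
      a * (p - 1) < lam.rowLen j → lam.rowLen j < (a + 1) * (p - 1) → i = j

/-- The `j`th block of `p - 1` columns of the diagram of `λ` (`j` starting at `0`), moved to the
left margin. -/
def block (p : ℕ) (lam : YoungDiagram) (j : ℕ) : YoungDiagram where
  cells := (Finset.range (lam.colLen 0) ×ˢ Finset.range (p - 1)).filter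
    fun c => (c.1, j * (p - 1) + c.2) ∈ lam
  isLowerSet := by
    rintro ⟨i, c⟩ ⟨i', c'⟩ ⟨hi, hc⟩ h
    simp only [Finset.coe_filter, Finset.mem_product, Finset.mem_range, Set.mem_ofPred_eq] at h ⊢
    simp only at hi hc
    exact ⟨⟨by omega, by omega⟩, lam.up_left_mem hi (by omega) h.2⟩

theorem mem_block (p : ℕ) (lam : YoungDiagram) (j i c : ℕ) :
    (i, c) ∈ block p lam j ↔ c < p - 1 ∧ (i, j * (p - 1) + c) ∈ lam := by
  rw [← YoungDiagram.mem_cells, block]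
  simp only [Finset.mem_filter, Finset.mem_product, Finset.mem_range]
  refine ⟨fun h => ⟨h.1.2, h.2⟩, fun h => ⟨⟨?_, h.1⟩, h.2⟩⟩
  exact YoungDiagram.mem_iff_lt_colLen.1 (lam.up_left_mem le_rfl (Nat.zero_le _) h.2)

/-- The number `m` of (nonempty) blocks of `p - 1` columns, the length of `γ`. -/
def numBlocks (p : ℕ) (lam : YoungDiagram) : ℕ := lam.rowLen 0 ⌈/⌉ (p - 1)

/-- The T-conjugate `γ`: `tconj p lam j` is `γ_{j+1}`, the number of boxes of the `j`th block. -/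
def tconj (p : ℕ) (lam : YoungDiagram) (j : ℕ) : ℕ := (block p lam j).card

/-- The T-conjugate as the list `[γ_1, …, γ_m]`. -/
def tconjList (p : ℕ) (lam : YoungDiagram) : List ℕ :=
  (List.range (numBlocks p lam)).map (tconj p lam)

/-- `ε(λ) = ∑_{j=1}^{⌊m/2⌋} (-1)^{j-1} γ_{2j}`. -/
def epsilon (p : ℕ) (lam : YoungDiagram) : ℤ :=
  ∑ j ∈ Finset.Icc 1 (numBlocks p lam / 2), (-1) ^ (j - 1) * (tconj p lam (2 * j - 1) : ℤ)

/-! ### Milnor spikes -/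

/-- For `k = a(p-1) + b` with `1 ≤ b ≤ p-1`, the number `(b+1)p^a - 1`; and `0` for `k = 0`. -/
def spikeExp (p k : ℕ) : ℕ :=
  if k = 0 then 0 else ((k - 1) % (p - 1) + 2) * p ^ ((k - 1) / (p - 1)) - 1

/-- The Milnor spike associated to a sequence `(c_1, …, c_t)` of positive integers, acting on
`F_p[x_1, …, x_n]`: it is `P(r_1, …, r_t)` with `r_i = (b_i+1)p^{a_i} - 1`, where
`c_i = a_i(p-1) + b_i` and `1 ≤ b_i ≤ p-1`. -/
noncomputable def milnorSpike (p n : ℕ) (c : List ℕ) :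
    MvPolynomial (Fin n) (ZMod p) →ₗ[ZMod p] MvPolynomial (Fin n) (ZMod p) :=
  milnorP p n (c.map (spikeExp p)).toFinsupp

/-! ### The polynomials -/

/-- The variable `x_{j+1}` for `j < n`; the value `0` for `j ≥ n` is never used. -/
noncomputable def var (p n j : ℕ) : MvPolynomial (Fin n) (ZMod p) :=
  if h : j < n then MvPolynomial.X ⟨j, h⟩ else 0

/-- The determinant `[x_{a+1}, x_{a+2}^p, …, x_{a+s}^{p^{s-1}}]`, which has the entry
`x_{a+j+1}^{p^i}` in row `i` and column `j`, for `0 ≤ i, j < s`. -/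
noncomputable def vdm (p n a s : ℕ) : MvPolynomial (Fin n) (ZMod p) :=
  Matrix.det (Matrix.of fun i j : Fin s => var p n (a + j) ^ p ^ (i : ℕ))

/-- `w(μ') = ∏_j w(μ'_j)`, the product over the columns of the diagram of `μ`, where
`w(k) = [x_1, x_2^p, …, x_k^{p^{k-1}}]`. -/
noncomputable def wPoly (p n : ℕ) (mu : YoungDiagram) : MvPolynomial (Fin n) (ZMod p) :=
  ∏ j ∈ Finset.range (mu.rowLen 0), vdm p n 0 (mu.colLen j)

/-- `p(λ') = ∏_{j=1}^m w(λ_{(j)}')^{p^{j-1}}`, where `λ_{(j)}` is the `j`th block of `λ`. -/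
noncomputable def pPoly (p n : ℕ) (lam : YoungDiagram) : MvPolynomial (Fin n) (ZMod p) :=
  ∏ j ∈ Finset.range (numBlocks p lam), wPoly p n (block p lam j) ^ p ^ j

/-- The rows that meet the `k`th antidiagonal (`k` starting at `0`), which consists of the boxes
`(i, j)` with `j + i(p-1) = k`. Each row meets it at most once. -/
def antidiagRows (p : ℕ) (lam : YoungDiagram) (k : ℕ) : Finset ℕ :=
  (lam.cells.filter fun c => c.2 + c.1 * (p - 1) = k).image Prod.fst

/-- `v_k(λ)`: the determinant `[x_{i-s+1}, …, x_i^{p^{s-1}}]` where the `k`th antidiagonal has its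
highest box in row `i - s + 1` and its lowest in row `i`; its length is `s`, as the antidiagonals
of a column `p`-regular partition meet consecutive rows. -/
noncomputable def vFactor (p n : ℕ) (lam : YoungDiagram) (k : ℕ) :
    MvPolynomial (Fin n) (ZMod p) :=
  vdm p n (sInf (antidiagRows p lam k : Set ℕ)) (antidiagRows p lam k).card

/-- `v(λ)`, the product of the `v_k(λ)` over the `γ_1` antidiagonals. -/
noncomputable def vPoly (p n : ℕ) (lam : YoungDiagram) : MvPolynomial (Fin n) (ZMod p) :=
  ∏ k ∈ Finset.range (tconj p lam 0), vFactor p n lam k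

/-- `s(λ)`, the leading monomial of `v(λ)` in left lexicographic order, with coefficient `1`. -/
noncomputable def sPoly (p n : ℕ) (lam : YoungDiagram) : MvPolynomial (Fin n) (ZMod p) :=
  MvPolynomial.monomial (MonomialOrder.lex.degree (vPoly p n lam)) 1

end TRegular

open TRegular

/-!
The coaction becomes a homomorphism into a polynomial ring when `ξ_0` is kept as a variable:
`x_i ↦ L_i = ∑_{k < N} x_i^{p^k} ξ_k`. On a polynomial `f` of degree `d`, the operation `P(R)` picks
out the coefficient of `ξ_0^{d - |R|} ξ^R` (`milnorP_eq_coeff`). If `|R| = d`, then `ξ_0` is absent,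
and the coefficient is the `p`th power of the coefficient for the shifted sequence
(`milnorP_eq_coeff_pow`). So the theorem concerns one exponent for `s(λ)` and `v(λ)`, with entries
`spikeExp p λ_i`, and one for `w(λ')`, with entries `spikeExp p γ_i`: the spikes associated to these
sequences without their first entry give the coefficients themselves, and those associated to the
whole sequences give the `p`th powers.

The number `spikeExp p L` is the sum of `p^{⌊x/(p-1)⌋}` over `x < L`, so its `c`th base `p` digit is
the size of the `c`th block of `p - 1` columns in a row of length `L`. The three polynomials are
built from products of factors `x_i^{p^c}`, mapped to linear forms in the `ξ_k^{p^c}`, and the number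
of factors with a given `c` is the sum of the `c`th digits of the exponent. This is the least number
possible, so the coefficient splits into a product over `c` of coefficients whose exponents are the
digits, all less than `p` (`coeff_prod_expand_linear`). For each `c` all `p`th powers of variables
may be discarded, hence, in characteristic `p`, all `p`th powers of linear forms.

* `s(λ)` is the product of `x_r^{p^{⌊x/(p-1)⌋}}` over the boxes `(r, x)`. By T-regularity each block
  of columns has the shape `((p-1)^s, b)`, and the coefficient for that block is computed by Cramer's
  rule (`coeff_prod_rowForm`): it is a product of powers of two leading minors of `(x_r^{p^{k+c}})`,
  which is the corresponding factor of `p(λ')`.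
* In the expansion of `v(λ)`, each choice of one term from every determinant other than the choice
  of all leading terms uses some `x_r^{p^c}` at least `p` times (`eq_revPerm_of_card_le`), so it
  contributes zero. The leading terms give `± s(λ)`.
* The determinants in `w(λ')` are expanded by rows, each row being a combination of the rows
  `(x_j^{p^{c+k}})_j` with coefficients `ξ_k^{p^c}`. Repeated rows and the count of the `ξ_k^{p^c}`
  leave only the choice in which the determinants of the `a`th block of columns come from `ξ_a`
  (`eq_div_of_card_eq`), and that choice gives `p(λ')`.
-/

namespace MilnorSpike

open MvPolynomial Finset

/-! ### Separating the base `p` digits of an exponent -/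

section Digits

variable {σ A : Type*} [CommRing A]

/-- If the exponents of `m` are less than `p` and `G` is homogeneous of degree `|m|`, then the
coefficient at `m + pE` of `G(ξ) H(ξ^p)` separates: an exponent `u` of `G` with
`u ≡ m` modulo `p` satisfies `u ≥ m`, hence `u = m`. -/
theorem coeff_mul_expand {p : ℕ} (hp : p ≠ 0) {G : MvPolynomial σ A} (H : MvPolynomial σ A)
    {m : σ →₀ ℕ} (E : σ →₀ ℕ) (hG : G.IsHomogeneous m.degree) (hm : ∀ k, m k < p) :
    coeff (m + p • E) (G * expand p H) = coeff m G * coeff E H := by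
  classical
  rw [coeff_mul, Finset.sum_eq_single (m, p • E)]
  · rw [coeff_expand_smul _ hp]
  · rintro ⟨u, v⟩ huv hne
    by_contra h0
    have hu : coeff u G ≠ 0 := left_ne_zero_of_mul h0
    have hv : coeff v (expand p H) ≠ 0 := right_ne_zero_of_mul h0
    have huv' : u + v = m + p • E := mem_antidiagonal.1 huv
    have hdeg : u.degree = m.degree := by
      by_contra h
      exact hu (hG.coeff_eq_zero h)
    have hle : m ≤ u := by
      intro k
      have hk : p ∣ v k := by
        by_contra h
        exact hv (coeff_expand_of_not_dvd _ h)
      have h1 : u k + v k = m k + p * E k := by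
        simpa using DFunLike.congr_fun huv' k
      obtain ⟨t, ht⟩ := hk
      have h2 : u k % p = m k := by
        have := congrArg (· % p) h1
        simpa [ht, Nat.mod_eq_of_lt (hm k)] using this
      exact h2 ▸ Nat.mod_le _ _
    have humm : u = m := by
      obtain ⟨d, rfl⟩ := exists_add_of_le hle
      have : d.degree = 0 := by
        rw [map_add] at hdeg
        omega
      rw [(Finsupp.degree_eq_zero_iff d).1 this, add_zero]
    subst humm
    exact hne (by rw [add_left_cancel huv'])
  · intro h
    exact (h (by simp)).elim

theorem coeff_prod_expand {p : ℕ} (hp : p ≠ 0) (C : ℕ) (G : ℕ → MvPolynomial σ A)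
    (m : ℕ → σ →₀ ℕ) (hG : ∀ c, (G c).IsHomogeneous (m c).degree) (hm : ∀ c k, m c k < p) :
    coeff (∑ c ∈ range C, p ^ c • m c) (∏ c ∈ range C, expand (p ^ c) (G c)) =
      ∏ c ∈ range C, coeff (m c) (G c) := by
  induction C generalizing G m with
  | zero => simp
  | succ C ih =>
    rw [Finset.sum_range_succ', Finset.prod_range_succ', Finset.prod_range_succ',
      ← ih (fun c => G (c + 1)) (fun c => m (c + 1)) (fun c => hG _) (fun c => hm _), mul_comm,
      add_comm, pow_zero, one_smul, expand_one_apply, mul_comm _ (coeff (m 0) (G 0)),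
      ← coeff_mul_expand hp _ _ (hG 0) (hm 0), map_prod, Finset.smul_sum]
    simp only [pow_succ', mul_smul, expand_mul]

/-- Digit separation for a product of linear forms `h i`, the `i`th taken in the variables
`ξ_k^{p^c}` with `c = lev i`. -/
theorem coeff_prod_expand_linear {ι : Type*} {p : ℕ} (hp : p ≠ 0) (C : ℕ) (s : Finset ι)
    (lev : ι → ℕ) (hlev : ∀ i ∈ s, lev i < C) (h : ι → MvPolynomial σ A)
    (hh : ∀ i ∈ s, (h i).IsHomogeneous 1) (m : ℕ → σ →₀ ℕ) (hm : ∀ c k, m c k < p)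
    (hcard : ∀ c, #{i ∈ s | lev i = c} = (m c).degree) :
    coeff (∑ c ∈ range C, p ^ c • m c) (∏ i ∈ s, expand (p ^ lev i) (h i)) =
      ∏ c ∈ range C, coeff (m c) (∏ i ∈ s with lev i = c, h i) := by
  rw [← coeff_prod_expand hp C _ m _ hm]
  · congr 1
    rw [← Finset.prod_fiberwise_of_maps_to (g := lev) (t := range C)
      (fun i hi => Finset.mem_range.2 (hlev i hi))]
    refine Finset.prod_congr rfl fun c _ => ?_
    rw [map_prod]
    refine Finset.prod_congr rfl fun i hi => ?_
    rw [(Finset.mem_filter.1 hi).2]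
  · intro c
    rw [← hcard c, Finset.card_eq_sum_ones]
    exact IsHomogeneous.prod _ _ _ fun i hi => hh i (Finset.mem_filter.1 hi).1

end Digits

/-! ### Powers of linear forms modulo `p`th powers of the variables -/

section Core

variable {σ A : Type*} [CommRing A]

/-- The ideal of polynomials none of whose exponents is `≤ m`. -/
def exponentIdeal (m : σ →₀ ℕ) : Ideal (MvPolynomial σ A) where
  carrier := {g | ∀ u ≤ m, coeff u g = 0}
  add_mem' ha hb u hu := by rw [coeff_add, ha u hu, hb u hu, add_zero]
  zero_mem' u _ := coeff_zero u
  smul_mem' c g hg u hu := by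
    classical
    rw [smul_eq_mul, coeff_mul]
    refine Finset.sum_eq_zero fun x hx => ?_
    rw [hg x.2 (le_trans ?_ hu), mul_zero]
    rw [← mem_antidiagonal.1 hx]
    exact le_add_self

theorem X_pow_mem_exponentIdeal {m : σ →₀ ℕ} {k : σ} {e : ℕ} (h : m k < e) :
    (X k ^ e : MvPolynomial σ A) ∈ exponentIdeal m := by
  classical
  intro u hu
  rw [coeff_X_pow, if_neg]
  rintro rfl
  have := hu k
  rw [Finsupp.single_eq_same] at this
  omega

/-- In characteristic `p`, the `p`th power of a linear form is a combination of `p`th powers of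
the variables. -/
theorem linear_pow_mem_exponentIdeal {p : ℕ} [Fact p.Prime] [CharP A p] {m : σ →₀ ℕ}
    (hm : ∀ k, m k < p) (s : Finset σ) (f : σ → A) :
    (∑ k ∈ s, C (f k) * X k) ^ p ∈ exponentIdeal m := by
  rw [sum_pow_char]
  refine Ideal.sum_mem _ fun k _ => ?_
  rw [mul_pow]
  exact Ideal.mul_mem_left _ _ (X_pow_mem_exponentIdeal (hm k))

end Core

section CoreNat

variable {A : Type*} [CommRing A] (α : ℕ → ℕ → A)

/-- The leading principal minors of the matrix with entries `α`, transposed. -/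
def leadingMinor (s : ℕ) : A := Matrix.det (Matrix.of fun i j : Fin s => α j i)

/-- The linear form `∑_{k < N} α r k ξ_k`. -/
noncomputable def rowForm (N r : ℕ) : MvPolynomial ℕ A := ∑ k ∈ range N, C (α r k) * X k

/-- The exponent `((p-1)^s, b)`, with `q` in the place of `p - 1`. -/
noncomputable def rectExp (q s b : ℕ) : ℕ →₀ ℕ :=
  ∑ k ∈ range s, Finsupp.single k q + Finsupp.single s b

theorem rectExp_apply (q s b k : ℕ) :
    rectExp q s b k = if k < s then q else if k = s then b else 0 := by
  classical
  simp only [rectExp, Finsupp.add_apply, Finsupp.finsetSum_apply, Finsupp.single_apply,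
    Finset.sum_ite_eq', Finset.mem_range]
  split_ifs <;> omega

/-- Cramer's rule: some combination of the first `s + 1` rows with last coefficient the
`s`th leading minor equals the `(s+1)`st leading minor times the unit vector at `s`, up to columns
of index greater than `s`. -/
theorem exists_cramer (s : ℕ) : ∃ u : ℕ → A, u s = leadingMinor α s ∧ ∀ k ≤ s,
    ∑ r ∈ range (s + 1), u r * α r k = if k = s then leadingMinor α (s + 1) else 0 := by
  set M : Matrix (Fin (s + 1)) (Fin (s + 1)) A := Matrix.of fun i j => α j i with hM
  refine ⟨fun r => if h : r < s + 1 then M.adjugate ⟨r, h⟩ (Fin.last s) else 0, ?_, ?_⟩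
  · have : (⟨s, Nat.lt_succ_self s⟩ : Fin (s + 1)) = Fin.last s := rfl
    simp only [Nat.lt_succ_self, dif_pos, this]
    rw [Matrix.adjugate_fin_succ_eq_det_submatrix, Fin.val_last, Even.neg_one_pow ⟨s, rfl⟩, one_mul,
      leadingMinor]
    congr 1
    ext i j
    simp [hM]
  · intro k hk
    have h1 := congrFun (congrFun (Matrix.mul_adjugate M) ⟨k, by omega⟩) (Fin.last s)
    rw [Matrix.mul_apply] at h1
    rw [Finset.sum_range]
    simp only [Fin.is_lt, dif_pos, Fin.eta]
    simp only [mul_comm _ (α _ _)]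
    refine h1.trans ?_
    simp [Matrix.one_apply, Fin.ext_iff, leadingMinor, hM]

theorem rowForm_pow_mul_mem {p : ℕ} [Fact p.Prime] [CharP A p] {m : ℕ →₀ ℕ} (hm : ∀ k, m k < p)
    (N s : ℕ) {r : ℕ} (hr : r < s) :
    (∏ i ∈ range s, rowForm α N i ^ (p - 1)) * rowForm α N r ∈ exponentIdeal m := by
  rw [← Finset.mul_prod_erase _ _ (Finset.mem_range.2 hr), mul_right_comm, ← pow_succ,
    Nat.sub_add_cancel (Fact.out : p.Prime).one_le]
  exact Ideal.mul_mem_right _ _ (linear_pow_mem_exponentIdeal hm _ _)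

/-- Multiplying `ℓ_s` by the `s`th minor turns it, by Cramer's rule, into a multiple of `ξ_s` modulo
`ℓ_0, …, ℓ_{s-1}` and higher variables, all of which may be discarded. -/
theorem leadingMinor_pow_mul_coeff {p : ℕ} [Fact p.Prime] [CharP A p] {N s b : ℕ} (hs : s < N)
    (hb : b ≤ p - 1) :
    leadingMinor α s ^ b * coeff (rectExp (p - 1) s b)
        ((∏ i ∈ range s, rowForm α N i ^ (p - 1)) * rowForm α N s ^ b) =
      leadingMinor α (s + 1) ^ b *
        coeff (rectExp (p - 1) s 0) (∏ i ∈ range s, rowForm α N i ^ (p - 1)) := by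
  have hp := (Fact.out : p.Prime).two_le
  set P : MvPolynomial ℕ A := ∏ i ∈ range s, rowForm α N i ^ (p - 1) with hP
  set m := rectExp (p - 1) s b with hm
  have hmlt : ∀ k, m k < p := by
    intro k
    rw [hm, rectExp_apply]
    split_ifs <;> omega
  obtain ⟨u, hus, hu⟩ := exists_cramer α s
  have hmem : P * (C (leadingMinor α s) * rowForm α N s - C (leadingMinor α (s + 1)) * X s) ∈
      exponentIdeal m := by
    -- Cramer's rule leaves only variables `ξ_k` with `k > s`, where `m k = 0`
    have h1 : ∑ r ∈ range (s + 1), C (u r) * rowForm α N r - C (leadingMinor α (s + 1)) * X s ∈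
        exponentIdeal m := by
      have h2 : ∑ r ∈ range (s + 1), C (u r) * rowForm α N r =
          ∑ k ∈ range N, C (∑ r ∈ range (s + 1), u r * α r k) * X k := by
        simp only [rowForm, Finset.mul_sum, map_sum, Finset.sum_mul, map_mul, mul_assoc]
        rw [Finset.sum_comm]
      rw [h2, ← Finset.add_sum_erase _ _ (Finset.mem_range.2 hs), hu s le_rfl, if_pos rfl,
        add_sub_cancel_left]
      refine Ideal.sum_mem _ fun k hk => ?_
      rcases le_or_gt k s with hks | hks
      · rw [hu k hks, if_neg (Finset.ne_of_mem_erase hk), C_0, zero_mul]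
        exact Ideal.zero_mem _
      · refine Ideal.mul_mem_left _ _ ?_
        rw [← pow_one (X k)]
        refine X_pow_mem_exponentIdeal ?_
        rw [hm, rectExp_apply, if_neg (by omega), if_neg (by omega)]
        exact one_pos
    have h3 : P * (C (leadingMinor α s) * rowForm α N s - C (leadingMinor α (s + 1)) * X s) =
        P * (∑ r ∈ range (s + 1), C (u r) * rowForm α N r - C (leadingMinor α (s + 1)) * X s) -
          ∑ r ∈ range s, C (u r) * (P * rowForm α N r) := by
      rw [Finset.sum_range_succ, hus]
      simp only [mul_left_comm _ P, ← Finset.mul_sum]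
      ring
    rw [h3]
    exact Ideal.sub_mem _ (Ideal.mul_mem_left _ _ h1) (Ideal.sum_mem _ fun r hr =>
      Ideal.mul_mem_left _ _ (rowForm_pow_mul_mem α hmlt N s (Finset.mem_range.1 hr)))
  have hpow : P * ((C (leadingMinor α s) * rowForm α N s) ^ b -
      (C (leadingMinor α (s + 1)) * X s) ^ b) ∈ exponentIdeal m := by
    obtain ⟨t, ht⟩ := sub_dvd_pow_sub_pow (C (leadingMinor α s) * rowForm α N s)
      (C (leadingMinor α (s + 1)) * X s) b
    rw [ht, ← mul_assoc]
    exact Ideal.mul_mem_right _ _ hmem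
  have hc := hpow m le_rfl
  rw [mul_sub, coeff_sub, sub_eq_zero, mul_pow, mul_pow, ← C_pow, ← C_pow, mul_left_comm,
    coeff_C_mul, mul_left_comm, coeff_C_mul] at hc
  rw [hc]
  congr 1
  have hm0 : m = rectExp (p - 1) s 0 + Finsupp.single s b := by simp [hm, rectExp]
  rw [hm0, X_pow_eq_monomial, coeff_mul_monomial, mul_one]

theorem coeff_prod_rowForm_of_square [IsDomain A] {p : ℕ} [Fact p.Prime] [CharP A p]
    {N s : ℕ} (hD : ∀ i ≤ s, leadingMinor α i ≠ 0) (hs : s ≤ N) :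
    coeff (rectExp (p - 1) s 0) (∏ i ∈ range s, rowForm α N i ^ (p - 1)) =
      leadingMinor α s ^ (p - 1) := by
  induction s with
  | zero => simp [rectExp, leadingMinor]
  | succ s ih =>
    have h := leadingMinor_pow_mul_coeff α (N := N) (s := s) (b := p - 1) hs le_rfl
    rw [ih (fun i hi => hD i (by omega)) (by omega), mul_comm (leadingMinor α (s + 1) ^ _)] at h
    rw [Finset.prod_range_succ]
    refine mul_left_cancel₀ (pow_ne_zero (p - 1) (hD s (Nat.le_succ s))) (Eq.trans ?_ h)
    congr 2
    simp [rectExp, Finset.sum_range_succ]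

/-- The coefficient of `ξ_0^{p-1} ⋯ ξ_{s-1}^{p-1} ξ_s^b` in `ℓ_0^{p-1} ⋯ ℓ_{s-1}^{p-1} ℓ_s^b` for
linear forms `ℓ_i` over a domain of characteristic `p`. -/
theorem coeff_prod_rowForm [IsDomain A] {p : ℕ} [Fact p.Prime] [CharP A p]
    {N s b : ℕ} (hD : ∀ i ≤ s, leadingMinor α i ≠ 0) (hs : s < N) (hb : b ≤ p - 1) :
    coeff (rectExp (p - 1) s b) ((∏ i ∈ range s, rowForm α N i ^ (p - 1)) * rowForm α N s ^ b) =
      leadingMinor α (s + 1) ^ b * leadingMinor α s ^ (p - 1 - b) := by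
  have h := leadingMinor_pow_mul_coeff α hs hb
  rw [coeff_prod_rowForm_of_square α hD hs.le] at h
  refine mul_left_cancel₀ (pow_ne_zero b (hD s le_rfl)) (h.trans ?_)
  rw [mul_left_comm, ← pow_add, Nat.add_sub_cancel' hb]

end CoreNat

/-! ### The homogenized coaction -/

section Coaction

variable (p n : ℕ)

/-- The matrix with entries `x_{r+1}^{p^{k+c}}`; its row `r` lists the coefficients of the `p^c`th
power of the coaction on `x_{r+1}`. -/
noncomputable def powerRow (c r k : ℕ) : MvPolynomial (Fin n) (ZMod p) := var p n r ^ p ^ (k + c)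

/-- The coaction made homogeneous by treating `ξ_0` as a variable, and truncated to
`ξ_0, …, ξ_{N-1}`. Here the polynomial variable `k : ℕ` is `ξ_k`. -/
noncomputable def homCoaction (N : ℕ) :
    MvPolynomial (Fin n) (ZMod p) →ₐ[ZMod p] MvPolynomial ℕ (MvPolynomial (Fin n) (ZMod p)) :=
  aeval fun i => rowForm (powerRow p n 0) N i

variable {p n}

theorem var_fin (i : Fin n) : var p n i = X i := by simp [var]

theorem homCoaction_X (N : ℕ) (i : Fin n) :
    homCoaction p n N (X i) = rowForm (powerRow p n 0) N i := aeval_X _ _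

theorem homCoaction_var [Fact p.Prime] (N r : ℕ) :
    homCoaction p n N (var p n r) = rowForm (powerRow p n 0) N r := by
  by_cases h : r < n
  · rw [var, dif_pos h, homCoaction_X]
  · have h0 : ∀ k, p ^ k ≠ 0 := fun k => pow_ne_zero _ (Fact.out : p.Prime).ne_zero
    simp only [var, h, rowForm, powerRow, dite_false, map_zero, zero_pow (h0 _), zero_mul,
      Finset.sum_const_zero]

theorem milnorP_mul_X (R : ℕ →₀ ℕ) (f : MvPolynomial (Fin n) (ZMod p)) (i : Fin n) :
    milnorP p n R (f * X i) = milnorP p n R f * X i +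
      ∑ k ∈ R.support, milnorP p n (R - Finsupp.single k 1) f * X i ^ p ^ (k + 1) := by
  classical
  have hinj : Set.InjOn (fun k : ℕ => (Finsupp.single k 1 : ℕ →₀ ℕ)) R.support := by
    intro a _ b _ h
    exact (Finsupp.single_left_inj one_ne_zero).1 h
  -- only `P(0)` and the `P(R)` with `R` a unit sequence are nonzero on `X i`
  set T : Finset (ℕ →₀ ℕ) := insert 0 (R.support.image fun k => Finsupp.single k 1) with hT
  have hTle : ∀ e ∈ T, e ≤ R := by
    intro e he
    rcases Finset.mem_insert.1 he with rfl | he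
    · exact zero_le
    · obtain ⟨k, hk, rfl⟩ := Finset.mem_image.1 he
      rw [Finsupp.single_le_iff]
      exact Nat.one_le_iff_ne_zero.2 (Finsupp.mem_support_iff.1 hk)
  have hsum : milnorP p n R (f * X i) =
      ∑ e ∈ T, milnorP p n (R - e) f * milnorP p n e (X i) := by
    rw [milnorP_mul]
    symm
    rw [← Finset.sum_image (s := T) (g := fun e => (R - e, e))
      (f := fun d => milnorP p n d.1 f * milnorP p n d.2 (X i))
      (fun a _ b _ h => congrArg Prod.snd h)]
    refine Finset.sum_subset ?_ ?_
    · intro d hd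
      obtain ⟨e, he, rfl⟩ := Finset.mem_image.1 hd
      exact mem_antidiagonal.2 (tsub_add_cancel_of_le (hTle e he))
    · rintro ⟨d, e⟩ hde hnot
      have hde : d + e = R := mem_antidiagonal.1 hde
      rw [milnorP_X_eq_zero, mul_zero]
      · rintro rfl
        refine hnot (Finset.mem_image.2 ⟨0, by simp [hT], ?_⟩)
        rw [← hde]
        simp
      · rintro k rfl
        refine hnot (Finset.mem_image.2 ⟨Finsupp.single k 1, ?_, ?_⟩)
        · refine Finset.mem_insert_of_mem (Finset.mem_image_of_mem _ ?_)
          rw [← hde]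
          simp
        · rw [← hde]
          simp
  rw [hsum, hT, Finset.sum_insert, Finset.sum_image hinj, milnorP_zero_X, tsub_zero]
  · simp only [milnorP_single_X]
  · simp

theorem milnorP_one (R : ℕ →₀ ℕ) : milnorP p n R 1 = if R = 0 then 1 else 0 := by
  classical
  change MvPowerSeries.coeff R (coaction p n 1) = _
  rw [map_one, MvPowerSeries.coeff_one]

theorem exists_add_single {d : Fin n →₀ ℕ} {k : ℕ} (h : d.degree = k + 1) :
    ∃ d' i, d'.degree = k ∧ d = d' + Finsupp.single i 1 := by
  have hd : d ≠ 0 := by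
    rintro rfl
    simp at h
  obtain ⟨i, hi⟩ := Finsupp.ne_iff.1 hd
  have hle : Finsupp.single i 1 ≤ d := by
    rw [Finsupp.single_le_iff]
    exact Nat.one_le_iff_ne_zero.2 hi
  refine ⟨d - Finsupp.single i 1, i, ?_, (tsub_add_cancel_of_le hle).symm⟩
  have := congrArg Finsupp.degree (tsub_add_cancel_of_le hle)
  rw [map_add, Finsupp.degree_single] at this
  omega

theorem monomial_add_single_one (d : Fin n →₀ ℕ) (i : Fin n) :
    monomial (d + Finsupp.single i 1) (1 : ZMod p) = monomial d 1 * X i := by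
  rw [X, monomial_mul, one_mul]

/-- `P(R)` vanishes on polynomials of degree less than `|R|`. -/
theorem milnorP_monomial_eq_zero {d : Fin n →₀ ℕ} {R : ℕ →₀ ℕ} (h : d.degree < R.degree) :
    milnorP p n R (monomial d 1) = 0 := by
  generalize hk : d.degree = k at h
  induction k generalizing d R with
  | zero =>
    rw [Finsupp.degree_eq_zero_iff] at hk
    subst hk
    rw [← C_apply, C_1, milnorP_one, if_neg]
    rintro rfl
    simp at h
  | succ k ih =>
    obtain ⟨d', i, hd', rfl⟩ := exists_add_single hk
    rw [monomial_add_single_one, milnorP_mul_X, ih hd' (by omega), zero_mul, zero_add]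
    refine Finset.sum_eq_zero fun j hj => ?_
    rw [ih hd', zero_mul]
    have hle : Finsupp.single j 1 ≤ R := by
      rw [Finsupp.single_le_iff]
      exact Nat.one_le_iff_ne_zero.2 (Finsupp.mem_support_iff.1 hj)
    have := congrArg Finsupp.degree (tsub_add_cancel_of_le hle)
    rw [map_add, Finsupp.degree_single] at this
    omega

theorem coeff_mul_rowForm {A : Type*} [CommRing A] (α : ℕ → ℕ → A) (N r : ℕ) (E : ℕ →₀ ℕ)
    (g : MvPolynomial ℕ A) :
    coeff E (g * rowForm α N r) =
      ∑ k ∈ range N, if E k = 0 then 0 else coeff (E - Finsupp.single k 1) g * α r k := by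
  classical
  rw [rowForm, Finset.mul_sum, coeff_sum]
  refine Finset.sum_congr rfl fun k _ => ?_
  rw [mul_left_comm, coeff_C_mul, coeff_mul_X']
  by_cases hk : E k = 0
  · simp [hk]
  · rw [if_neg hk, if_pos (Finsupp.mem_support_iff.2 hk), mul_comm]

theorem degree_eq_sum_range {E : ℕ →₀ ℕ} {N : ℕ} (hE : ∀ k, N ≤ k → E k = 0) :
    E.degree = ∑ k ∈ range N, E k := by
  rw [Finsupp.degree_apply]
  refine Finset.sum_subset (fun k hk => ?_) fun k _ hk => by simpa using hk
  rw [Finset.mem_range]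
  by_contra h
  exact Finsupp.mem_support_iff.1 hk (hE k (by omega))

theorem degree_eq_add_degree_tail {E R : ℕ →₀ ℕ} {N : ℕ} (hE : ∀ k, N + 1 ≤ k → E k = 0)
    (hR : ∀ k, R k = E (k + 1)) : E.degree = E 0 + R.degree := by
  rw [degree_eq_sum_range hE, Finset.sum_range_succ', add_comm,
    degree_eq_sum_range (E := R) (N := N) fun k hk => by rw [hR, hE _ (by omega)]]
  simp only [hR]

/-- On homogeneous polynomials, Milnor's coaction is the homogenized one with `ξ_0 = 1`. -/
theorem milnorP_monomial_eq_coeff {N : ℕ} {d : Fin n →₀ ℕ} {E R : ℕ →₀ ℕ}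
    (hE : E.degree = d.degree) (hEN : ∀ k, N ≤ k → E k = 0) (hR : ∀ k, R k = E (k + 1)) :
    milnorP p n R (monomial d 1) = coeff E (homCoaction p n N (monomial d 1)) := by
  generalize hk : d.degree = k at hE
  induction k generalizing d E R with
  | zero =>
    rw [Finsupp.degree_eq_zero_iff] at hk hE
    subst hk hE
    have : R = 0 := by
      ext k
      simp [hR]
    rw [← C_apply, C_1, milnorP_one, if_pos this, map_one, coeff_zero_one]
  | succ k ih =>
    obtain ⟨d', i, hd', rfl⟩ := exists_add_single hk
    have hsub : ∀ j, E j ≠ 0 → (E - Finsupp.single j 1).degree = k := by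
      intro j hj
      have hle : Finsupp.single j 1 ≤ E := by
        rw [Finsupp.single_le_iff]
        exact Nat.one_le_iff_ne_zero.2 hj
      have := congrArg Finsupp.degree (tsub_add_cancel_of_le hle)
      rw [map_add, Finsupp.degree_single] at this
      omega
    have hsubN : ∀ j l, N ≤ l → (E - Finsupp.single j 1 : ℕ →₀ ℕ) l = 0 := by
      intro j l hl
      rw [Finsupp.tsub_apply, hEN l hl, zero_tsub]
    obtain _ | N := N
    · have : E = 0 := by
        ext k
        exact hEN k (Nat.zero_le _)
      subst this
      simp at hE
    rw [monomial_add_single_one, map_mul (homCoaction p n (N + 1)), homCoaction_X, coeff_mul_rowForm, milnorP_mul_X,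
      Finset.sum_range_succ', add_comm]
    congr 1
    · have hsupp : R.support = {j ∈ range N | ¬ E (j + 1) = 0} := by
        ext j
        rw [Finsupp.mem_support_iff, hR, Finset.mem_filter, Finset.mem_range]
        refine ⟨fun h => ⟨?_, h⟩, fun h => h.2⟩
        by_contra hj
        exact h (hEN _ (by omega))
      rw [hsupp, Finset.sum_filter]
      refine Finset.sum_congr rfl fun j _ => ?_
      rw [ite_not]
      split_ifs with hj
      · rfl
      · rw [ih (hsubN _) (fun l => ?_) hd' (hsub _ hj), powerRow, var_fin, add_zero]
        simp [hR, Finsupp.single_apply]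
    · split_ifs with h0
      · -- without `ξ_0` in the exponent, `|R|` exceeds the degree of the remaining monomial
        rw [milnorP_monomial_eq_zero, zero_mul]
        rw [degree_eq_add_degree_tail hEN hR, h0] at hE
        omega
      · rw [ih (hsubN _) (fun l => ?_) hd' (hsub _ h0), powerRow, var_fin, zero_add, pow_zero,
          pow_one]
        simp [hR]

theorem milnorP_eq_coeff {N D : ℕ} {f : MvPolynomial (Fin n) (ZMod p)} (hf : f.IsHomogeneous D)
    {E R : ℕ →₀ ℕ} (hE : E.degree = D) (hEN : ∀ k, N ≤ k → E k = 0)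
    (hR : ∀ k, R k = E (k + 1)) :
    milnorP p n R f = coeff E (homCoaction p n N f) := by
  have h : ∀ d, monomial d (coeff d f) = coeff d f • monomial d (1 : ZMod p) := by
    intro d
    rw [smul_monomial, smul_eq_mul, mul_one]
  rw [f.as_sum, map_sum, map_sum, coeff_sum]
  refine Finset.sum_congr rfl fun d hd => ?_
  rw [h, map_smul, map_smul, milnorP_monomial_eq_coeff _ hEN hR, coeff_smul]
  rw [hE, ← hf (mem_support_iff.1 hd), Finsupp.degree_eq_weight_one]
  rfl

/-- If `|R|` is the degree of `f`, only the terms of the coaction without `ξ_0` count. They are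
obtained by renaming `ξ_k` to `ξ_{k+1}` and applying the Frobenius map to the coefficients. -/
theorem milnorP_eq_coeff_pow [Fact p.Prime] {N D : ℕ} {f : MvPolynomial (Fin n) (ZMod p)}
    (hf : f.IsHomogeneous D) {R : ℕ →₀ ℕ} (hR : R.degree = D) (hRN : ∀ k, N ≤ k → R k = 0) :
    milnorP p n R f = coeff R (homCoaction p n N f) ^ p := by
  set E : ℕ →₀ ℕ := R.mapDomain Nat.succ with hEdef
  have hE0 : E 0 = 0 := Finsupp.mapDomain_of_notMem_range _ _ (by simp)
  have hE : ∀ k, R k = E (k + 1) := fun k =>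
    (Finsupp.mapDomain_apply Nat.succ_injective R k).symm
  have hEN : ∀ k, N + 1 ≤ k → E k = 0 := by
    rintro (_ | k) hk
    · exact hE0
    · rw [← hE, hRN k (by omega)]
  have hED : E.degree = D := by rw [degree_eq_add_degree_tail hEN hE, hE0, hR, zero_add]
  rw [milnorP_eq_coeff hf hED hEN hE, ← frobenius_def, ← coeff_map,
    ← coeff_rename_mapDomain Nat.succ Nat.succ_injective _ R, ← hEdef, ← sub_eq_zero, ← coeff_sub]
  refine (?_ : _ ∈ exponentIdeal E) E le_rfl
  rw [← Ideal.Quotient.eq]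
  -- `E 0 = 0`, so `ξ_0` vanishes in the quotient, where both sides are ring homomorphisms in `f`
  suffices h : (Ideal.Quotient.mk (exponentIdeal E)).comp (homCoaction p n (N + 1)).toRingHom =
      (Ideal.Quotient.mk (exponentIdeal E)).comp
        (((rename Nat.succ).toRingHom.comp (MvPolynomial.map (frobenius _ p))).comp
          (homCoaction p n N).toRingHom) from DFunLike.congr_fun h f
  refine MvPolynomial.ringHom_ext' (Subsingleton.elim _ _) fun i => ?_
  simp only [RingHom.comp_apply, AlgHom.toRingHom_eq_coe, RingHom.coe_coe]
  rw [Ideal.Quotient.eq, homCoaction_X, homCoaction_X, rowForm, rowForm, Finset.sum_range_succ',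
    map_sum, map_sum, add_comm, add_sub_assoc]
  refine Ideal.add_mem _ (Ideal.mul_mem_left _ _ ?_) ?_
  · rw [← pow_one (X 0)]
    exact X_pow_mem_exponentIdeal (by rw [hE0]; exact one_pos)
  · rw [← Finset.sum_sub_distrib]
    refine Ideal.sum_mem _ fun k _ => ?_
    simp only [powerRow, var_fin, add_zero, map_pow, map_mul, map_C, map_X, frobenius_def,
      rename_C, rename_X, pow_succ, pow_mul]
    rw [pow_right_comm, sub_self]
    exact Ideal.zero_mem _

end Coaction

/-! ### The determinants `[x_{a+1}, x_{a+2}^p, …]` -/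

section Vdm

variable {p n : ℕ}

theorem var_isHomogeneous (r : ℕ) : (var p n r).IsHomogeneous 1 := by
  unfold var
  split_ifs
  · exact isHomogeneous_X _ _
  · exact isHomogeneous_zero _ _ _

theorem vdm_eq_sum (a s : ℕ) : vdm p n a s =
    ∑ σ : Equiv.Perm (Fin s), Equiv.Perm.sign σ • ∏ j : Fin s, var p n (a + j) ^ p ^ (σ j : ℕ) :=
  Matrix.det_apply _

theorem vdm_isHomogeneous (a s : ℕ) : (vdm p n a s).IsHomogeneous (∑ i : Fin s, p ^ (i : ℕ)) := by
  rw [vdm_eq_sum]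
  refine IsHomogeneous.sum _ _ _ fun σ _ => ?_
  have h : (∏ j : Fin s, var p n (a + j) ^ p ^ (σ j : ℕ)).IsHomogeneous
      (∑ i : Fin s, p ^ (i : ℕ)) := by
    rw [← Equiv.sum_comp σ]
    refine IsHomogeneous.prod _ _ _ fun j _ => ?_
    simpa using (var_isHomogeneous (p := p) (n := n) (a + j)).pow (p ^ (σ j : ℕ))
  rw [Units.smul_def, zsmul_eq_mul]
  have h2 := (isHomogeneous_C (Fin n) (((Equiv.Perm.sign σ : ℤˣ) : ℤ) : ZMod p)).mul h
  rwa [map_intCast, zero_add] at h2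

theorem leadingMinor_powerRow [Fact p.Prime] (c s : ℕ) :
    leadingMinor (powerRow p n c) s = vdm p n 0 s ^ p ^ c := by
  rw [leadingMinor, vdm, ← iterateFrobenius_def, RingHom.map_det]
  congr 1
  ext i j : 2
  simp [powerRow, iterateFrobenius_def, pow_add, pow_mul]

/-- The exponent of the term of `[x_{a+1}, …, x_{a+s}^{p^{s-1}}]` indexed by a permutation. -/
noncomputable def permExp (p : ℕ) {n a s : ℕ} (h : a + s ≤ n) (σ : Equiv.Perm (Fin s)) :
    Fin n →₀ ℕ :=
  ∑ j : Fin s, Finsupp.single ⟨a + j, by omega⟩ (p ^ (σ j : ℕ))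

theorem permExp_apply_of_ne {a s : ℕ} (h : a + s ≤ n) (σ : Equiv.Perm (Fin s)) (i : Fin n)
    (hi : ∀ j : Fin s, a + j ≠ i) : permExp p h σ i = 0 := by
  rw [permExp, Finsupp.finsetSum_apply]
  refine Finset.sum_eq_zero fun j _ => ?_
  rw [Finsupp.single_apply, if_neg]
  intro h
  exact hi j (congrArg Fin.val h)

theorem permExp_apply {a s : ℕ} (h : a + s ≤ n) (σ : Equiv.Perm (Fin s)) (j : Fin s)
    (hj : a + j < n) : permExp p h σ ⟨a + j, hj⟩ = p ^ (σ j : ℕ) := by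
  rw [permExp, Finsupp.finsetSum_apply, Finset.sum_eq_single j]
  · simp
  · intro k _ hk
    rw [Finsupp.single_apply, if_neg]
    intro h
    have := congrArg Fin.val h
    exact hk (Fin.ext (by simpa using this))
  · simp

theorem prod_var_eq_monomial {a s : ℕ} (h : a + s ≤ n) (σ : Equiv.Perm (Fin s)) :
    ∏ j : Fin s, var p n (a + j) ^ p ^ (σ j : ℕ) = monomial (permExp p h σ) 1 := by
  rw [permExp, monomial_sum_one]
  refine Finset.prod_congr rfl fun j _ => ?_
  rw [var, dif_pos (show a + (j : ℕ) < n by omega), X_pow_eq_monomial]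

theorem permExp_injective [Fact p.Prime] {a s : ℕ} (h : a + s ≤ n) :
    Function.Injective (permExp p h) := by
  intro σ τ hst
  ext j
  have := DFunLike.congr_fun hst ⟨a + j, by omega⟩
  rw [permExp_apply, permExp_apply] at this
  exact Nat.pow_right_injective (Fact.out : p.Prime).two_le this

/-- The order-reversing permutation gives the leading exponent in lexicographic order. -/
theorem permExp_lt [Fact p.Prime] {a s : ℕ} (h : a + s ≤ n) {σ : Equiv.Perm (Fin s)}
    (hσ : σ ≠ Fin.revPerm) : toLex (permExp p h σ) < toLex (permExp p h Fin.revPerm) := by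
  classical
  have hex : ∃ j : ℕ, ∃ hj : j < s, σ ⟨j, hj⟩ ≠ Fin.revPerm ⟨j, hj⟩ := by
    by_contra hcon
    push Not at hcon
    exact hσ (Equiv.ext fun j => hcon j j.2)
  obtain ⟨hj, hne⟩ := Nat.find_spec hex
  set j := Nat.find hex with hjdef
  have hmin : ∀ i (hi : i < s), i < j → σ ⟨i, hi⟩ = Fin.revPerm ⟨i, hi⟩ := by
    intro i hi hij
    by_contra hc
    exact Nat.find_min hex hij ⟨hi, hc⟩
  rw [Finsupp.Lex.lt_iff]
  refine ⟨⟨a + j, by omega⟩, fun i hi => ?_, ?_⟩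
  · rw [Fin.lt_def] at hi
    simp only at hi
    by_cases hai : a ≤ i
    · obtain ⟨t, ht⟩ := Nat.exists_eq_add_of_le hai
      have hi' : i = ⟨a + t, by omega⟩ := Fin.ext ht
      have h1 := permExp_apply (p := p) h σ ⟨t, by omega⟩ (by simp; omega)
      have h2 := permExp_apply (p := p) h Fin.revPerm ⟨t, by omega⟩ (by simp; omega)
      rw [hmin t (by omega) (by omega), ← h2] at h1
      rw [hi']
      exact h1
    · have h0 : ∀ k : Fin s, a + (k : ℕ) ≠ i := fun k => by omega
      simp [permExp_apply_of_ne h _ i h0]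
  · have h1 := permExp_apply (p := p) h σ ⟨j, hj⟩ (by simp; omega)
    have h2 := permExp_apply (p := p) h Fin.revPerm ⟨j, hj⟩ (by simp; omega)
    simp only [ofLex_toLex] at h1 h2 ⊢
    rw [h1, h2]
    refine Nat.pow_lt_pow_right (Fact.out : p.Prime).one_lt ?_
    by_contra hlt
    rw [Fin.revPerm_apply, Fin.val_rev] at hlt
    have hne' : (σ ⟨j, hj⟩ : ℕ) ≠ s - (j + 1) := fun h => hne (Fin.ext (by
      rw [Fin.revPerm_apply, Fin.val_rev]
      exact h))
    simp only at hlt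
    have hs := (σ ⟨j, hj⟩).2
    -- the value `σ j` is already taken at the smaller index `s - 1 - σ j`
    have h3 := hmin (s - 1 - σ ⟨j, hj⟩) (by omega) (by omega)
    have h4 : σ ⟨s - 1 - σ ⟨j, hj⟩, by omega⟩ = σ ⟨j, hj⟩ := by
      rw [h3]
      ext
      rw [Fin.revPerm_apply, Fin.val_rev]
      simp only
      omega
    have h5 := congrArg Fin.val (σ.injective h4)
    simp only at h5
    omega

theorem sign_revPerm (s : ℕ) :
    Equiv.Perm.sign (Fin.revPerm : Equiv.Perm (Fin s)) = (-1) ^ (s / 2) := by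
  have hsq : (Fin.revPerm : Equiv.Perm (Fin s)) ^ 2 = 1 := by
    ext i
    simp [pow_two]
  rw [Equiv.Perm.sign_of_pow_two_eq_one hsq, Fintype.card_fin]
  congr 1
  -- there is at most one fixed point, and none if `s` is even
  have hfix : ∀ i ∈ Function.fixedPoints (Fin.revPerm : Equiv.Perm (Fin s)),
      2 * (i : ℕ) + 1 = s := by
    intro i hi
    have := congrArg Fin.val (show Fin.rev i = i from hi)
    rw [Fin.val_rev] at this
    omega
  have hle : Fintype.card (Function.fixedPoints (Fin.revPerm : Equiv.Perm (Fin s))) ≤ 1 := by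
    rw [Fintype.card_le_one_iff]
    rintro ⟨i, hi⟩ ⟨j, hj⟩
    have hi' := hfix i hi
    have hj' := hfix j hj
    exact Subtype.ext (Fin.ext (show (i : ℕ) = j by omega))
  rcases Nat.even_or_odd' s with ⟨t, ht | ht⟩
  · have h0 : Fintype.card (Function.fixedPoints (Fin.revPerm : Equiv.Perm (Fin s))) = 0 := by
      rw [Fintype.card_eq_zero_iff]
      refine ⟨fun i => ?_⟩
      have := hfix i i.2
      omega
    rw [h0, Nat.sub_zero]
  · omega

theorem coeff_vdm_permExp_rev [Fact p.Prime] {a s : ℕ} (h : a + s ≤ n) :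
    coeff (permExp p h Fin.revPerm) (vdm p n a s) =
      ((Equiv.Perm.sign (Fin.revPerm : Equiv.Perm (Fin s)) : ℤˣ) : ℤ) := by
  classical
  rw [vdm_eq_sum, coeff_sum, Finset.sum_eq_single Fin.revPerm]
  · rw [prod_var_eq_monomial h, Units.smul_def, zsmul_eq_mul, ← map_intCast (C : ZMod p →+* _),
      coeff_C_mul, coeff_monomial, if_pos rfl, mul_one]
  · intro σ _ hσ
    rw [prod_var_eq_monomial h, Units.smul_def, zsmul_eq_mul, ← map_intCast (C : ZMod p →+* _),
      coeff_C_mul, coeff_monomial, if_neg (fun h' => hσ (permExp_injective h h')), mul_zero]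
  · simp

theorem coeff_vdm_permExp_rev_ne_zero [Fact p.Prime] {a s : ℕ} (h : a + s ≤ n) :
    coeff (permExp p h Fin.revPerm) (vdm p n a s) ≠ 0 := by
  rw [coeff_vdm_permExp_rev]
  rcases Int.units_eq_one_or (Equiv.Perm.sign (Fin.revPerm : Equiv.Perm (Fin s))) with h | h <;>
  simp [h]

theorem vdm_ne_zero [Fact p.Prime] {a s : ℕ} (h : a + s ≤ n) : vdm p n a s ≠ 0 := by
  intro h0
  apply coeff_vdm_permExp_rev_ne_zero (p := p) h
  rw [h0, coeff_zero]

theorem degree_vdm [Fact p.Prime] {a s : ℕ} (h : a + s ≤ n) :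
    MonomialOrder.lex.degree (vdm p n a s) = permExp p h Fin.revPerm := by
  classical
  refine MonomialOrder.lex.toSyn.injective (le_antisymm ?_ ?_)
  · rw [MonomialOrder.degree_le_iff]
    intro d hd
    rw [mem_support_iff, vdm_eq_sum, coeff_sum] at hd
    obtain ⟨σ, _, hσ⟩ := Finset.exists_ne_zero_of_sum_ne_zero hd
    rw [prod_var_eq_monomial h, Units.smul_def, zsmul_eq_mul, ← map_intCast (C : ZMod p →+* _),
      coeff_C_mul, coeff_monomial] at hσ
    have : permExp p h σ = d := by
      by_contra hne
      rw [if_neg hne, mul_zero] at hσ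
      exact hσ rfl
    subst this
    rw [MonomialOrder.lex_le_iff]
    by_cases h' : σ = Fin.revPerm
    · rw [h']
    · exact (permExp_lt h h').le
  · exact MonomialOrder.le_degree
      (mem_support_iff.2 (coeff_vdm_permExp_rev_ne_zero h))

theorem rowForm_pow [Fact p.Prime] (N r c : ℕ) :
    rowForm (powerRow p n 0) N r ^ p ^ c = expand (p ^ c) (rowForm (powerRow p n c) N r) := by
  rw [rowForm, rowForm, sum_pow_char_pow, map_sum]
  refine Finset.sum_congr rfl fun k _ => ?_
  rw [mul_pow, map_mul, expand_C, expand_X, ← C_pow, powerRow, powerRow, add_zero, pow_add,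
    pow_mul]

theorem rowForm_isHomogeneous {A : Type*} [CommRing A] (α : ℕ → ℕ → A) (N r : ℕ) :
    (rowForm α N r).IsHomogeneous 1 := by
  refine IsHomogeneous.sum _ _ _ fun k _ => ?_
  simpa using (isHomogeneous_C ℕ (α r k)).mul (isHomogeneous_X A k)

end Vdm

/-! ### The exponents of Milnor spikes and their base `p` digits -/

section Spike

/-- The number of `x < L` in the `c`th block of `q` consecutive integers. With `q = p - 1` it is the
`c`th base `p` digit of `spikeExp p L`. -/
def blockCount (q L c : ℕ) : ℕ := #{x ∈ range L | x / q = c}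

theorem blockCount_eq {q : ℕ} (hq : 0 < q) (L c : ℕ) : blockCount q L c = min q (L - c * q) := by
  have : {x ∈ range L | x / q = c} = Ico (c * q) (min L ((c + 1) * q)) := by
    ext x
    rw [Finset.mem_filter, Finset.mem_range, Finset.mem_Ico, Nat.div_eq_iff hq, lt_min_iff,
      Nat.succ_mul]
    omega
  rw [blockCount, this, Nat.card_Ico, Nat.succ_mul]
  omega

theorem blockCount_mul {q : ℕ} (hq : 0 < q) (L c : ℕ) :
    blockCount q (q * L) c = if c < L then q else 0 := by
  rw [blockCount_eq hq, mul_comm c, ← Nat.mul_sub]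
  split_ifs with h
  · exact min_eq_left (Nat.le_mul_of_pos_right _ (by omega))
  · rw [Nat.sub_eq_zero_of_le (by omega), mul_zero, min_eq_right (Nat.zero_le _)]

theorem spikeExp_succ_add_one {p : ℕ} (hp : 2 ≤ p) (L : ℕ) :
    spikeExp p (L + 1) + 1 = (L % (p - 1) + 2) * p ^ (L / (p - 1)) := by
  rw [spikeExp, if_neg (Nat.succ_ne_zero L), Nat.add_sub_cancel, Nat.sub_add_cancel]
  exact Nat.mul_pos (by omega) (pow_pos (by omega) _)

theorem spikeExp_add_one {p : ℕ} (hp : 2 ≤ p) (L : ℕ) :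
    spikeExp p L + 1 = (L % (p - 1) + 1) * p ^ (L / (p - 1)) := by
  obtain _ | L := L
  · simp [spikeExp]
  · rw [spikeExp_succ_add_one hp]
    obtain ⟨q, rfl⟩ : ∃ q, p = q + 1 := ⟨p - 1, by omega⟩
    rw [Nat.add_sub_cancel]
    have hlt := Nat.mod_lt L (show 0 < q by omega)
    have hL := Nat.div_add_mod L q
    set t := L / q
    set u := L % q
    rcases Nat.lt_or_ge (u + 1) q with h | h
    · have h1 : (L + 1) / q = t := by
        rw [Nat.div_eq_iff (by omega)]
        rw [mul_comm t q]
        omega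
      have h2 : (L + 1) % q = u + 1 := by
        have := Nat.div_add_mod (L + 1) q
        rw [h1] at this
        omega
      rw [h1, h2]
    · have h1 : L + 1 = q * (t + 1) := by
        rw [Nat.mul_succ]
        omega
      rw [h1, Nat.mul_mod_right, Nat.mul_div_cancel_left _ (by omega), pow_succ,
        show u + 2 = q + 1 by omega]
      ring

theorem spikeExp_eq_sum {p : ℕ} (hp : 2 ≤ p) (L : ℕ) :
    spikeExp p L = ∑ x ∈ range L, p ^ (x / (p - 1)) := by
  induction L with
  | zero => simp [spikeExp]
  | succ L ih =>
    rw [Finset.sum_range_succ, ← ih]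
    have h1 := spikeExp_succ_add_one hp L
    have h2 := spikeExp_add_one hp L
    rw [Nat.succ_mul] at h1
    omega

/-- The exponent with entries `spikeExp p (L k)` for `k < K`. -/
noncomputable def spikeSeq (p K : ℕ) (L : ℕ → ℕ) : ℕ →₀ ℕ :=
  ∑ k ∈ range K, Finsupp.single k (spikeExp p (L k))

/-- The `c`th base `p` digits of `spikeSeq p K L`. -/
noncomputable def digitSeq (p K : ℕ) (L : ℕ → ℕ) (c : ℕ) : ℕ →₀ ℕ :=
  ∑ k ∈ range K, Finsupp.single k (blockCount (p - 1) (L k) c)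

theorem sum_single_apply (K : ℕ) (f : ℕ → ℕ) (k : ℕ) :
    (∑ k ∈ range K, Finsupp.single k (f k) : ℕ →₀ ℕ) k = if k < K then f k else 0 := by
  classical
  simp [Finsupp.finsetSum_apply, Finsupp.single_apply]

theorem digitSeq_lt {p : ℕ} (hp : 2 ≤ p) (K : ℕ) (L : ℕ → ℕ) (c k : ℕ) :
    digitSeq p K L c k < p := by
  rw [digitSeq, sum_single_apply]
  split_ifs
  · rw [blockCount_eq (by omega)]
    have := min_le_left (p - 1) (L k - c * (p - 1))
    omega
  · omega

theorem sum_fiber_pow {ι : Type*} (s : Finset ι) (lev : ι → ℕ) (p C : ℕ)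
    (h : ∀ i ∈ s, lev i < C) :
    ∑ c ∈ range C, p ^ c * #{i ∈ s | lev i = c} = ∑ i ∈ s, p ^ lev i := by
  rw [← Finset.sum_fiberwise_of_maps_to (g := lev) (t := range C)
    (fun i hi => Finset.mem_range.2 (h i hi))]
  refine Finset.sum_congr rfl fun c _ => ?_
  rw [Finset.sum_congr rfl (g := fun _ => p ^ c) fun i hi => by rw [(Finset.mem_filter.1 hi).2],
    Finset.sum_const, smul_eq_mul, mul_comm]

theorem sum_digitSeq {p : ℕ} (hp : 2 ≤ p) {K C : ℕ} {L : ℕ → ℕ}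
    (hC : ∀ k < K, ∀ x < L k, x / (p - 1) < C) :
    ∑ c ∈ range C, p ^ c • digitSeq p K L c = spikeSeq p K L := by
  ext k
  rw [Finsupp.finsetSum_apply]
  simp only [Finsupp.smul_apply, digitSeq, spikeSeq, sum_single_apply, smul_eq_mul]
  split_ifs with hk
  · rw [spikeExp_eq_sum hp]
    exact sum_fiber_pow _ _ _ _ fun x hx => hC k hk x (Finset.mem_range.1 hx)
  · simp

theorem degree_digitSeq (p K : ℕ) (L : ℕ → ℕ) (c : ℕ) :
    (digitSeq p K L c).degree = ∑ k ∈ range K, blockCount (p - 1) (L k) c := by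
  rw [digitSeq, map_sum]
  simp only [Finsupp.degree_single]

/-- Digit separation at the exponent of a Milnor spike. -/
theorem coeff_spikeSeq {A ι : Type*} [CommRing A] {p : ℕ} (hp : 2 ≤ p) {K C : ℕ} {L : ℕ → ℕ}
    (hC : ∀ k < K, ∀ x < L k, x / (p - 1) < C) (s : Finset ι) (lev : ι → ℕ)
    (hlev : ∀ i ∈ s, lev i < C) (h : ι → MvPolynomial ℕ A)
    (hh : ∀ i ∈ s, (h i).IsHomogeneous 1)
    (hcard : ∀ c, #{i ∈ s | lev i = c} = ∑ k ∈ range K, blockCount (p - 1) (L k) c) :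
    coeff (spikeSeq p K L) (∏ i ∈ s, expand (p ^ lev i) (h i)) =
      ∏ c ∈ range C, coeff (digitSeq p K L c) (∏ i ∈ s with lev i = c, h i) := by
  rw [← sum_digitSeq hp hC]
  exact coeff_prod_expand_linear (by omega) C s lev hlev h hh _ (digitSeq_lt hp K L)
    fun c => (hcard c).trans (degree_digitSeq p K L c).symm

end Spike

/-! ### Products over the boxes of a diagram -/

section Diagram

@[to_additive]
theorem prod_cells {M : Type*} [CommMonoid M] (lam : YoungDiagram) (f : ℕ × ℕ → M) {K : ℕ}
    (hK : lam.colLen 0 ≤ K) :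
    ∏ b ∈ lam.cells, f b = ∏ r ∈ range K, ∏ x ∈ range (lam.rowLen r), f (r, x) := by
  rw [Finset.prod_sigma']
  refine Finset.prod_nbij' (fun b => ⟨b.1, b.2⟩) (fun b => (b.1, b.2)) ?_ ?_ ?_ ?_ ?_
  · rintro ⟨r, x⟩ hb
    rw [YoungDiagram.mem_cells] at hb
    simp only [Finset.mem_sigma, Finset.mem_range]
    refine ⟨?_, YoungDiagram.mem_iff_lt_rowLen.1 hb⟩
    exact (YoungDiagram.mem_iff_lt_colLen.1
      (lam.up_left_mem le_rfl (Nat.zero_le _) hb)).trans_le hK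
  · rintro ⟨r, x⟩ hb
    simp only [Finset.mem_sigma, Finset.mem_range] at hb
    exact YoungDiagram.mem_iff_lt_rowLen.2 hb.2
  · simp
  · simp
  · simp

theorem card_cells_filter (lam : YoungDiagram) (q c : ℕ) {K : ℕ} (hK : lam.colLen 0 ≤ K) :
    #{b ∈ lam.cells | b.2 / q = c} = ∑ r ∈ range K, blockCount q (lam.rowLen r) c := by
  rw [Finset.card_filter]
  rw [sum_cells lam _ hK]
  simp only [blockCount, Finset.card_filter]

theorem lt_colLen_iff (lam : YoungDiagram) (i j : ℕ) : i < lam.colLen j ↔ j < lam.rowLen i := by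
  rw [← YoungDiagram.mem_iff_lt_colLen, YoungDiagram.mem_iff_lt_rowLen]

theorem numBlocks_spec {p : ℕ} (hp : 2 ≤ p) (lam : YoungDiagram) {r x : ℕ}
    (hx : x < lam.rowLen r) : x / (p - 1) < numBlocks p lam := by
  have h0 := lam.rowLen_anti 0 r (Nat.zero_le _)
  have h1 : lam.rowLen 0 ≤ (p - 1) * numBlocks p lam := by
    have := le_smul_ceilDiv (α := ℕ) (β := ℕ) (a := p - 1) (b := lam.rowLen 0) (by omega)
    simpa [numBlocks] using this
  rw [Nat.div_lt_iff_lt_mul (by omega), mul_comm]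
  omega

theorem vdm_zero (p n a : ℕ) : vdm p n a 0 = 1 := by simp [vdm]

theorem block_colLen {p : ℕ} (lam : YoungDiagram) (c : ℕ) {t : ℕ} (ht : t < p - 1) :
    (block p lam c).colLen t = lam.colLen (c * (p - 1) + t) := by
  refine eq_of_forall_lt_iff fun i => ?_
  rw [← YoungDiagram.mem_iff_lt_colLen, mem_block, YoungDiagram.mem_iff_lt_colLen]
  exact and_iff_right ht

theorem block_rowLen_zero_le (p : ℕ) (lam : YoungDiagram) (c : ℕ) :
    (block p lam c).rowLen 0 ≤ p - 1 := by
  refine le_of_forall_lt fun t ht => ?_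
  rw [← YoungDiagram.mem_iff_lt_rowLen, mem_block] at ht
  exact ht.1

theorem wPoly_block (p n : ℕ) (lam : YoungDiagram) (c : ℕ) :
    wPoly p n (block p lam c) =
      ∏ t ∈ range (p - 1), vdm p n 0 (lam.colLen (c * (p - 1) + t)) := by
  rw [wPoly, Finset.prod_subset (Finset.range_mono (block_rowLen_zero_le p lam c))]
  · exact Finset.prod_congr rfl fun t ht => by rw [block_colLen _ _ (Finset.mem_range.1 ht)]
  · intro t _ ht
    have : (block p lam c).colLen t = 0 := by
      by_contra h
      exact ht (Finset.mem_range.2 ((lt_colLen_iff _ _ _).1 (Nat.pos_of_ne_zero h)))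
    rw [this, vdm_zero]

theorem tconj_eq {p : ℕ} (hp : 2 ≤ p) (lam : YoungDiagram) (c : ℕ) :
    tconj p lam c = #{b ∈ lam.cells | b.2 / (p - 1) = c} := by
  refine Finset.card_nbij' (fun b => (b.1, c * (p - 1) + b.2)) (fun b => (b.1, b.2 % (p - 1)))
    ?_ ?_ ?_ ?_
  · rintro ⟨i, x⟩ h
    obtain ⟨hx, hmem⟩ := (mem_block p lam c i x).1 h
    simp only [Finset.coe_filter, Set.mem_ofPred_eq, YoungDiagram.mem_cells]
    refine ⟨hmem, ?_⟩
    rw [mul_comm, Nat.mul_add_div (by omega), Nat.div_eq_of_lt hx, add_zero]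
  · rintro ⟨i, x⟩ h
    simp only [Finset.coe_filter, Set.mem_ofPred_eq, YoungDiagram.mem_cells] at h
    refine (mem_block p lam c i _).2 ⟨Nat.mod_lt _ (by omega), ?_⟩
    rw [← h.2, mul_comm, Nat.div_add_mod]
    exact h.1
  · rintro ⟨i, x⟩ h
    obtain ⟨hx, -⟩ := (mem_block p lam c i x).1 h
    simp only [Prod.mk.injEq, true_and]
    rw [mul_comm, Nat.mul_add_mod, Nat.mod_eq_of_lt hx]
  · rintro ⟨i, x⟩ h
    simp only [Finset.coe_filter, Set.mem_ofPred_eq] at h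
    simp only [Prod.mk.injEq, true_and]
    rw [← h.2, mul_comm, Nat.div_add_mod]

theorem tconj_eq_sum {p : ℕ} (hp : 2 ≤ p) (lam : YoungDiagram) (c : ℕ) :
    tconj p lam c = ∑ r ∈ range (lam.colLen 0), blockCount (p - 1) (lam.rowLen r) c := by
  rw [tconj_eq hp, card_cells_filter _ _ _ le_rfl]

end Diagram

/-! ### The spike monomial -/

section SpikeMonomial

variable {p n : ℕ}

/-- The monomial `∏ x_r^{p^{⌊x/(p-1)⌋}}` over the boxes `(r, x)` of the diagram, in which the
exponent of `x_r` is `spikeExp p λ_r`. -/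
noncomputable def boxMonomial (p n : ℕ) (lam : YoungDiagram) : MvPolynomial (Fin n) (ZMod p) :=
  ∏ b ∈ lam.cells, var p n b.1 ^ p ^ (b.2 / (p - 1))

theorem prod_pow_rectExp {M : Type*} [CommMonoid M] (f : ℕ → M) {q s b K : ℕ} (hs : s < K) :
    ∏ r ∈ range K, f r ^ rectExp q s b r = (∏ r ∈ range s, f r ^ q) * f s ^ b := by
  rw [← Finset.prod_subset (Finset.range_mono (Nat.succ_le_of_lt hs)), Finset.prod_range_succ]
  · congr 1
    · refine Finset.prod_congr rfl fun r hr => ?_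
      rw [rectExp_apply, if_pos (Finset.mem_range.1 hr)]
    · rw [rectExp_apply, if_neg (lt_irrefl _), if_pos rfl]
  · intro r _ hr
    rw [Finset.mem_range] at hr
    rw [rectExp_apply, if_neg (by omega), if_neg (by omega), pow_zero]

theorem prod_cells_level {M : Type*} [CommMonoid M] (lam : YoungDiagram) (f : ℕ → M) (q c : ℕ)
    {K : ℕ} (hK : lam.colLen 0 ≤ K) :
    ∏ b ∈ lam.cells with b.2 / q = c, f b.1 =
      ∏ r ∈ range K, f r ^ blockCount q (lam.rowLen r) c := by
  rw [Finset.prod_filter, prod_cells _ _ hK]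
  refine Finset.prod_congr rfl fun r _ => ?_
  rw [← Finset.prod_filter]
  exact Finset.prod_const (f r)

/-- T-regularity says that each block of `p - 1` columns has the shape `((p-1)^s, b)`. -/
theorem exists_block_shape (hp : 2 ≤ p) {lam : YoungDiagram} (hreg : IsTRegular p lam) (c : ℕ) :
    ∃ s b, s ≤ lam.colLen 0 ∧ b ≤ p - 1 ∧
      (∀ r, blockCount (p - 1) (lam.rowLen r) c = rectExp (p - 1) s b r) ∧
      ∀ t < p - 1, lam.colLen (c * (p - 1) + t) = if t < b then s + 1 else s := by
  set q := p - 1 with hq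
  have hq0 : 0 < q := by omega
  have hlt := lt_colLen_iff lam
  -- `s` is the length of the last column of the block; row `s` is the only one that can end inside
  set s := lam.colLen (c * q + (q - 1)) with hs
  have hsrow : lam.rowLen s < c * q + q := by
    by_contra h
    exact lt_irrefl s ((hlt s (c * q + (q - 1))).2 (by omega))
  have hle : ∀ r < s, c * q + q ≤ lam.rowLen r := fun r hr => by
    have := (hlt r (c * q + (q - 1))).1 hr
    omega
  have hnext : ∀ r, s < r → lam.rowLen r ≤ c * q := by
    intro r hr
    by_contra h
    have h1 := lam.rowLen_anti s r hr.le
    have h2 : (c + 1) * q = c * q + q := Nat.succ_mul _ _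
    have h3 := hreg.2 c s r
    rw [← hq] at h3
    have := h3 (by omega) (by omega) (by omega) (by omega)
    omega
  refine ⟨s, lam.rowLen s - c * q, lam.colLen_anti _ _ (Nat.zero_le _), by omega, fun r => ?_,
    fun t ht => ?_⟩
  · rw [blockCount_eq hq0, rectExp_apply]
    split_ifs with h1 h2
    · have := hle r h1
      omega
    · subst h2
      omega
    · have := hnext r (by omega)
      omega
  · refine eq_of_forall_lt_iff fun r => ?_
    rw [hlt]
    split_ifs with h
    · rcases lt_trichotomy r s with h1 | h1 | h1
      · have := hle r h1
        omega
      · subst h1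
        omega
      · have := hnext r h1
        omega
    · rcases lt_trichotomy r s with h1 | h1 | h1
      · have := hle r h1
        omega
      · subst h1
        omega
      · have := hnext r h1
        omega

theorem coeff_block [Fact p.Prime] {lam : YoungDiagram} (hlen : lam.colLen 0 = n)
    (hreg : IsTRegular p lam) {N : ℕ} (hN : n < N) (c : ℕ) :
    coeff (digitSeq p n lam.rowLen c)
        (∏ b ∈ lam.cells with b.2 / (p - 1) = c, rowForm (powerRow p n c) N b.1) =
      wPoly p n (block p lam c) ^ p ^ c := by
  have hp := (Fact.out : p.Prime).two_le
  obtain ⟨s, b, hs, hb, hcount, hcol⟩ := exists_block_shape hp hreg c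
  have hdig : digitSeq p n lam.rowLen c = rectExp (p - 1) s b := by
    ext k
    rw [digitSeq, sum_single_apply, ← hcount]
    split_ifs with hk
    · rfl
    · have : lam.rowLen k = 0 := by
        by_contra h
        have := (lt_colLen_iff lam k 0).2 (Nat.pos_of_ne_zero h)
        omega
      rw [this, blockCount]
      simp
  rw [prod_cells_level lam (fun r => rowForm (powerRow p n c) N r) (p - 1) c
    (K := N) (by omega)]
  simp only [hcount]
  rw [prod_pow_rectExp _ (by omega), hdig, coeff_prod_rowForm _ _ (by omega) hb, wPoly_block,
    leadingMinor_powerRow, leadingMinor_powerRow, ← pow_mul, ← pow_mul, mul_comm (p ^ c),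
    mul_comm (p ^ c), pow_mul, pow_mul, ← mul_pow]
  · congr 1
    rw [Finset.prod_congr rfl (g := fun t => if t < b then vdm p n 0 (s + 1) else vdm p n 0 s)
      fun t ht => by rw [hcol t (Finset.mem_range.1 ht), apply_ite (vdm p n 0)],
      Finset.prod_ite, Finset.prod_const, Finset.prod_const]
    congr 2
    · rw [show {x ∈ range (p - 1) | x < b} = range b by ext x; simp; omega, Finset.card_range]
    · rw [show {x ∈ range (p - 1) | ¬ x < b} = Ico b (p - 1) by ext x; simp; omega, Nat.card_Ico]
  · intro i hi
    rw [leadingMinor_powerRow]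
    exact pow_ne_zero _ (vdm_ne_zero (by omega))

theorem coeff_boxMonomial [Fact p.Prime] {lam : YoungDiagram} (hlen : lam.colLen 0 = n)
    (hreg : IsTRegular p lam) {N : ℕ} (hN : n < N) :
    coeff (spikeSeq p n lam.rowLen) (homCoaction p n N (boxMonomial p n lam)) = pPoly p n lam := by
  have hp := (Fact.out : p.Prime).two_le
  have h := coeff_spikeSeq hp (C := numBlocks p lam) (K := n) (L := lam.rowLen)
    (fun k _ x hx => numBlocks_spec hp lam hx) lam.cells (fun b => b.2 / (p - 1))
    (fun b hb => numBlocks_spec hp lam (YoungDiagram.mem_iff_lt_rowLen.1 hb))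
    (fun b => rowForm (powerRow p n (b.2 / (p - 1))) N b.1)
    (fun _ _ => rowForm_isHomogeneous _ _ _) (fun c => card_cells_filter lam _ c hlen.le)
  rw [boxMonomial, map_prod, pPoly]
  simp only [map_pow, homCoaction_var, rowForm_pow]
  rw [h]
  refine Finset.prod_congr rfl fun c _ => ?_
  rw [← coeff_block hlen hreg hN c, Finset.prod_congr rfl fun b hb => ?_]
  rw [(Finset.mem_filter.1 hb).2]

theorem boxMonomial_isHomogeneous (lam : YoungDiagram) :
    (boxMonomial p n lam).IsHomogeneous (∑ b ∈ lam.cells, p ^ (b.2 / (p - 1))) := by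
  refine IsHomogeneous.prod _ _ _ fun b _ => ?_
  simpa using (var_isHomogeneous (p := p) (n := n) b.1).pow (p ^ (b.2 / (p - 1)))

end SpikeMonomial

/-! ### Antidiagonals of T-regular diagrams -/

section Antidiagonal

variable {p : ℕ} {lam : YoungDiagram}

/-- The highest row that meets the `k`th antidiagonal. -/
noncomputable def antidiagStart (p : ℕ) (lam : YoungDiagram) (k : ℕ) : ℕ :=
  sInf (antidiagRows p lam k : Set ℕ)

/-- The number of boxes on the `k`th antidiagonal. -/
def antidiagLen (p : ℕ) (lam : YoungDiagram) (k : ℕ) : ℕ := (antidiagRows p lam k).card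

theorem vFactor_eq (p n : ℕ) (lam : YoungDiagram) (k : ℕ) :
    vFactor p n lam k = vdm p n (antidiagStart p lam k) (antidiagLen p lam k) := rfl

theorem mem_antidiagRows (hp : 2 ≤ p) (k r : ℕ) : r ∈ antidiagRows p lam k ↔
    r ≤ k / (p - 1) ∧ k < lam.rowLen r + r * (p - 1) := by
  rw [antidiagRows, Finset.mem_image, Nat.le_div_iff_mul_le (by omega)]
  constructor
  · rintro ⟨⟨i, x⟩, hb, rfl⟩
    rw [Finset.mem_filter, YoungDiagram.mem_cells, YoungDiagram.mem_iff_lt_rowLen] at hb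
    simp only at hb ⊢
    omega
  · rintro ⟨h1, h2⟩
    refine ⟨(r, k - r * (p - 1)), ?_, rfl⟩
    rw [Finset.mem_filter, YoungDiagram.mem_cells, YoungDiagram.mem_iff_lt_rowLen]
    simp only
    omega

theorem rowLen_add_mul_mono (hcol : ColumnRegular p lam) :
    Monotone fun r => lam.rowLen r + r * (p - 1) := by
  refine monotone_nat_of_le_succ fun r => ?_
  have := hcol r
  rw [Nat.succ_mul]
  omega

theorem rowLen_colLen_zero (lam : YoungDiagram) : lam.rowLen (lam.colLen 0) = 0 := by
  by_contra h
  exact lt_irrefl _ ((lt_colLen_iff lam _ 0).2 (Nat.pos_of_ne_zero h))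

/-- T-regularity forces all rows but the last to have at least `p - 1` boxes. -/
theorem le_rowLen_of_lt (hreg : IsTRegular p lam) {r n : ℕ} (hlen : lam.colLen 0 = n + 1)
    (hr : r < n) : p - 1 ≤ lam.rowLen r := by
  by_contra h
  have h1 : 0 < lam.rowLen n := (lt_colLen_iff lam n 0).1 (by omega)
  have h2 := lam.rowLen_anti r n hr.le
  have := hreg.2 0 r n (by omega) (by omega) (by omega) (by omega)
  omega

theorem rowLen_last_le (hcol : ColumnRegular p lam) {n : ℕ} (hlen : lam.colLen 0 = n + 1) :
    lam.rowLen n ≤ p - 1 := by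
  have h1 := hcol n
  have h2 := rowLen_colLen_zero lam
  rw [hlen] at h2
  omega

/-- `γ_1 = (n-1)(p-1) + λ_n` for a T-regular partition `λ` with `n` parts. -/
theorem tconj_zero (hp : 2 ≤ p) (hreg : IsTRegular p lam) {n : ℕ} (hlen : lam.colLen 0 = n + 1) :
    tconj p lam 0 = lam.rowLen n + n * (p - 1) := by
  have hlast := rowLen_last_le hreg.1 hlen
  rw [tconj_eq_sum hp, hlen, Finset.sum_range_succ, blockCount_eq (by omega), zero_mul,
    Nat.sub_zero, min_eq_right hlast, add_comm]
  congr 1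
  rw [Finset.sum_congr rfl (g := fun _ => p - 1), Finset.sum_const, Finset.card_range, smul_eq_mul]
  intro r hr
  rw [blockCount_eq (by omega), zero_mul, Nat.sub_zero,
    min_eq_left (le_rowLen_of_lt hreg hlen (Finset.mem_range.1 hr))]

theorem lt_tconj_zero (hp : 2 ≤ p) (hreg : IsTRegular p lam) {r x : ℕ} (h : (r, x) ∈ lam) :
    x + r * (p - 1) < tconj p lam 0 := by
  rw [YoungDiagram.mem_iff_lt_rowLen] at h
  have hr : r < lam.colLen 0 := (lt_colLen_iff lam r 0).2 (by omega)
  obtain ⟨n, hn⟩ : ∃ n, lam.colLen 0 = n + 1 := ⟨lam.colLen 0 - 1, by omega⟩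
  rw [tconj_zero hp hreg hn]
  have := rowLen_add_mul_mono hreg.1 (show r ≤ n by omega)
  simp only at this
  omega

/-- The antidiagonals end in the first block of columns. -/
theorem div_mem_antidiagRows (hp : 2 ≤ p) (hreg : IsTRegular p lam) {k : ℕ}
    (hk : k < tconj p lam 0) : k / (p - 1) ∈ antidiagRows p lam k := by
  have hpos : 0 < lam.colLen 0 := by
    by_contra h
    rw [tconj_eq_sum hp, Nat.eq_zero_of_not_pos h] at hk
    simp at hk
  obtain ⟨n, hn⟩ : ∃ n, lam.colLen 0 = n + 1 := ⟨lam.colLen 0 - 1, by omega⟩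
  rw [mem_antidiagRows hp]
  refine ⟨le_rfl, ?_⟩
  rw [tconj_zero hp hreg hn] at hk
  have h1 := Nat.lt_div_mul_add (a := k) (show 0 < p - 1 by omega)
  rcases Nat.lt_or_ge (k / (p - 1)) n with h | h
  · have := le_rowLen_of_lt hreg hn h
    omega
  · have h2 := rowLen_last_le hreg.1 hn
    have h3 : k / (p - 1) < n + 1 := by
      rw [Nat.div_lt_iff_lt_mul (by omega), Nat.succ_mul]
      omega
    rw [show k / (p - 1) = n by omega]
    exact hk

theorem mem_antidiagRows_iff (hp : 2 ≤ p) (hreg : IsTRegular p lam) {k : ℕ}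
    (hk : k < tconj p lam 0) (r : ℕ) :
    r ∈ antidiagRows p lam k ↔ antidiagStart p lam k ≤ r ∧ r ≤ k / (p - 1) := by
  have hne : (antidiagRows p lam k : Set ℕ).Nonempty := ⟨_, div_mem_antidiagRows hp hreg hk⟩
  constructor
  · intro h
    exact ⟨Nat.sInf_le h, ((mem_antidiagRows hp k r).1 h).1⟩
  · rintro ⟨h1, h2⟩
    have h3 := (mem_antidiagRows hp k _).1 (Nat.sInf_mem hne)
    exact (mem_antidiagRows hp k r).2 ⟨h2, h3.2.trans_le (rowLen_add_mul_mono hreg.1 h1)⟩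

theorem antidiagStart_add_len (hp : 2 ≤ p) (hreg : IsTRegular p lam) {k : ℕ}
    (hk : k < tconj p lam 0) :
    antidiagStart p lam k + antidiagLen p lam k = k / (p - 1) + 1 := by
  have h : antidiagRows p lam k = Icc (antidiagStart p lam k) (k / (p - 1)) := by
    ext r
    rw [mem_antidiagRows_iff hp hreg hk, Finset.mem_Icc]
  have hle := ((mem_antidiagRows_iff hp hreg hk _).1 (div_mem_antidiagRows hp hreg hk)).1
  rw [antidiagLen, h, Nat.card_Icc]
  omega

theorem antidiagStart_add_len_le (hp : 2 ≤ p) (hreg : IsTRegular p lam) {k : ℕ}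
    (hk : k < tconj p lam 0) :
    antidiagStart p lam k + antidiagLen p lam k ≤ lam.colLen 0 := by
  rw [antidiagStart_add_len hp hreg hk, Nat.succ_le_iff, lt_colLen_iff]
  have h := (mem_antidiagRows hp k _).1 (div_mem_antidiagRows hp hreg hk)
  have := Nat.div_mul_le_self k (p - 1)
  omega

/-- A product over the boxes of the diagram, antidiagonal by antidiagonal. -/
@[to_additive]
theorem prod_antidiag {M : Type*} [CommMonoid M] (hp : 2 ≤ p) (hreg : IsTRegular p lam)
    (f : ℕ → ℕ → M) :
    ∏ k ∈ range (tconj p lam 0), ∏ j : Fin (antidiagLen p lam k),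
        f (antidiagStart p lam k + j) (Fin.rev j) =
      ∏ b ∈ lam.cells, f b.1 (b.2 / (p - 1)) := by
  rw [← Finset.prod_fiberwise_of_maps_to (s := lam.cells) (g := fun b => b.2 + b.1 * (p - 1))
    (t := range (tconj p lam 0))
    (fun b hb => Finset.mem_range.2 (lt_tconj_zero hp hreg (YoungDiagram.mem_cells b |>.1 hb)))]
  refine Finset.prod_congr rfl fun k hk => ?_
  rw [Finset.mem_range] at hk
  have hsum := antidiagStart_add_len hp hreg hk
  have h1 : ∏ j : Fin (antidiagLen p lam k), f (antidiagStart p lam k + j) (Fin.rev j) =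
      ∏ r ∈ antidiagRows p lam k, f r (k / (p - 1) - r) := by
    rw [show antidiagRows p lam k = Ico (antidiagStart p lam k)
        (antidiagStart p lam k + antidiagLen p lam k) by
      ext r
      rw [mem_antidiagRows_iff hp hreg hk, Finset.mem_Ico]
      omega, Finset.prod_Ico_eq_prod_range, Nat.add_sub_cancel_left, Finset.prod_range]
    refine Finset.prod_congr rfl fun j _ => ?_
    rw [Fin.val_rev]
    congr 1
    omega
  rw [h1, antidiagRows, Finset.prod_image]
  · refine Finset.prod_congr rfl fun b hb => ?_
    rw [← (Finset.mem_filter.1 hb).2, Nat.add_mul_div_right _ _ (by omega), Nat.add_sub_cancel]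
  · rintro ⟨i, x⟩ hb ⟨i', x'⟩ hb' h
    have h1 := (Finset.mem_filter.1 hb).2
    have h2 := (Finset.mem_filter.1 hb').2
    simp only at h1 h2 h
    subst h
    rw [Prod.mk.injEq]
    exact ⟨rfl, by omega⟩

theorem antidiagLen_le_numBlocks (hp : 2 ≤ p) (hreg : IsTRegular p lam) {k : ℕ}
    (hk : k < tconj p lam 0) : antidiagLen p lam k ≤ numBlocks p lam := by
  have h1 := antidiagStart_add_len hp hreg hk
  have h2 := (mem_antidiagRows_iff hp hreg hk _).1 (div_mem_antidiagRows hp hreg hk)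
  have h3 := (mem_antidiagRows hp k _).1
    ((mem_antidiagRows_iff hp hreg hk (antidiagStart p lam k)).2 ⟨le_rfl, h2.1⟩)
  rw [Nat.le_div_iff_mul_le (by omega)] at h3
  have h4 := numBlocks_spec hp lam (r := antidiagStart p lam k)
    (x := k - antidiagStart p lam k * (p - 1)) (by omega)
  rw [mul_comm, Nat.sub_mul_div] at h4
  omega

end Antidiagonal

/-! ### The product of the antidiagonal determinants -/

section VPoly

variable {p n : ℕ} {lam : YoungDiagram}

theorem monomial_degree_vdm [Fact p.Prime] {a s : ℕ} (h : a + s ≤ n) :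
    monomial (MonomialOrder.lex.degree (vdm p n a s)) (1 : ZMod p) =
      ∏ j : Fin s, var p n (a + j) ^ p ^ (Fin.rev j : ℕ) := by
  rw [degree_vdm h, ← prod_var_eq_monomial]
  rfl

theorem prod_antidiag_var [Fact p.Prime] (hreg : IsTRegular p lam) :
    ∏ k ∈ range (tconj p lam 0), ∏ j : Fin (antidiagLen p lam k),
        var p n (antidiagStart p lam k + j) ^ p ^ (Fin.rev j : ℕ) = boxMonomial p n lam :=
  prod_antidiag (Fact.out : p.Prime).two_le hreg fun r c => var p n r ^ p ^ c

theorem sPoly_eq_boxMonomial [Fact p.Prime] (hlen : lam.colLen 0 = n) (hreg : IsTRegular p lam) :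
    sPoly p n lam = boxMonomial p n lam := by
  have hp := (Fact.out : p.Prime).two_le
  have hle : ∀ k ∈ range (tconj p lam 0),
      antidiagStart p lam k + antidiagLen p lam k ≤ n := fun k hk =>
    (antidiagStart_add_len_le hp hreg (Finset.mem_range.1 hk)).trans_eq hlen
  rw [sPoly, vPoly, MonomialOrder.degree_prod, monomial_sum_one, ← prod_antidiag_var hreg]
  · refine Finset.prod_congr rfl fun k hk => ?_
    rw [vFactor_eq, monomial_degree_vdm (hle k hk)]
  · intro k hk
    rw [vFactor_eq]
    exact vdm_ne_zero (hle k hk)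

theorem prod_range_odd {M : Type*} [CommMonoid M] (g : ℕ → M) (hg : ∀ c, Even c → g c = 1)
    (m : ℕ) : ∏ c ∈ range m, g c = ∏ j ∈ Icc 1 (m / 2), g (2 * j - 1) := by
  rw [← Finset.prod_filter_mul_prod_filter_not (range m) Odd,
    Finset.prod_eq_one (s := {c ∈ range m | ¬ Odd c})
      (fun c hc => hg c (Nat.not_odd_iff_even.1 (Finset.mem_filter.1 hc).2)), mul_one]
  refine Finset.prod_nbij' (fun c => (c + 1) / 2) (fun j => 2 * j - 1) ?_ ?_ ?_ ?_ ?_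
  · intro c hc
    rw [Finset.mem_filter, Finset.mem_range] at hc
    obtain ⟨h, t, rfl⟩ := hc
    rw [Finset.mem_Icc]
    omega
  · intro j hj
    rw [Finset.mem_Icc] at hj
    rw [Finset.mem_filter, Finset.mem_range]
    exact ⟨by omega, j - 1, by omega⟩
  · intro c hc
    obtain ⟨t, rfl⟩ := (Finset.mem_filter.1 hc).2
    omega
  · intro j hj
    rw [Finset.mem_Icc] at hj
    omega
  · intro c hc
    obtain ⟨t, rfl⟩ := (Finset.mem_filter.1 hc).2
    congr 1
    omega

theorem negOnePow_sum {ι : Type*} (s : Finset ι) (f : ι → ℤ) :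
    (∑ i ∈ s, f i).negOnePow = ∏ i ∈ s, (f i).negOnePow := by
  classical
  induction s using Finset.induction_on with
  | empty => simp
  | insert a s ha ih => rw [Finset.sum_insert ha, Finset.prod_insert ha, Int.negOnePow_add, ih]

theorem negOnePow_epsilon (p : ℕ) (lam : YoungDiagram) : (epsilon p lam).negOnePow =
    ∏ j ∈ Icc 1 (numBlocks p lam / 2), (-1 : ℤˣ) ^ tconj p lam (2 * j - 1) := by
  rw [epsilon, negOnePow_sum]
  refine Finset.prod_congr rfl fun j _ => ?_
  rcases neg_one_pow_eq_or ℤ (j - 1) with h | h <;>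
  simp [h, Int.negOnePow_def]

/-- The sign of the leading term of `v(λ)`. -/
theorem prod_sign_rev (hp : 2 ≤ p) (hreg : IsTRegular p lam) :
    ∏ k ∈ range (tconj p lam 0),
      Equiv.Perm.sign (Fin.revPerm : Equiv.Perm (Fin (antidiagLen p lam k))) =
      (epsilon p lam).negOnePow := by
  set g : ℕ → ℤˣ := fun c => if Odd c then -1 else 1 with hg
  have hg1 : ∀ c, Even c → g c = 1 := fun c hc => if_neg (Nat.not_odd_iff_even.2 hc)
  have hodd : ∀ j ∈ Icc 1 (numBlocks p lam / 2), Odd (2 * j - 1) := fun j hj => by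
    rw [Finset.mem_Icc] at hj
    exact ⟨j - 1, by omega⟩
  have hsign : ∀ s : ℕ, Equiv.Perm.sign (Fin.revPerm : Equiv.Perm (Fin s)) =
      ∏ j : Fin s, g (Fin.rev j) := by
    intro s
    have hrev : ∏ j : Fin s, g (Fin.rev j) = ∏ j : Fin s, g j :=
      Equiv.prod_comp Fin.revPerm (fun j : Fin s => g j)
    rw [sign_revPerm, hrev, ← Finset.prod_range,
      prod_range_odd g hg1, Finset.prod_congr rfl (g := fun _ => -1), Finset.prod_const,
      Nat.card_Icc, Nat.add_sub_cancel]
    intro j hj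
    rw [Finset.mem_Icc] at hj
    exact if_pos ⟨j - 1, by omega⟩
  rw [Finset.prod_congr rfl fun k _ => hsign _, prod_antidiag hp hreg fun _ c => g c,
    ← Finset.prod_fiberwise_of_maps_to (s := lam.cells) (g := fun b => b.2 / (p - 1))
      (t := range (numBlocks p lam)) (fun b hb => Finset.mem_range.2
        (numBlocks_spec hp lam (YoungDiagram.mem_iff_lt_rowLen.1 hb))),
    Finset.prod_congr rfl (g := fun c => g c ^ tconj p lam c),
    prod_range_odd _ (fun c hc => by rw [hg1 c hc, one_pow]), negOnePow_epsilon]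
  · refine Finset.prod_congr rfl fun j hj => ?_
    rw [hg]
    simp only [if_pos (hodd j hj)]
  · intro c _
    rw [tconj_eq hp, ← Finset.prod_const]
    exact Finset.prod_congr rfl fun b hb => by rw [(Finset.mem_filter.1 hb).2]

/-- A linear form raised to a power `≥ p` contributes nothing to a coefficient with exponents
less than `p`. -/
theorem coeff_prod_rowForm_eq_zero [Fact p.Prime] {A ι : Type*} [CommRing A] [CharP A p]
    (α : ℕ → ℕ → A) (N : ℕ) (s : Finset ι) (row : ι → ℕ) {r : ℕ}
    (hr : p ≤ #{i ∈ s | row i = r}) {m : ℕ →₀ ℕ} (hm : ∀ k, m k < p) :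
    coeff m (∏ i ∈ s, rowForm α N (row i)) = 0 := by
  classical
  refine (?_ : _ ∈ exponentIdeal m) m le_rfl
  rw [← Finset.prod_filter_mul_prod_filter_not s (fun i => row i = r),
    Finset.prod_congr rfl (g := fun _ => rowForm α N r)
      (fun i hi => by rw [(Finset.mem_filter.1 hi).2]), Finset.prod_const,
    ← Nat.sub_add_cancel hr, pow_add]
  exact Ideal.mul_mem_right _ _ (Ideal.mul_mem_left _ _ (linear_pow_mem_exponentIdeal hm _ _))

/-- If a choice of one term from each antidiagonal determinant uses each power `x_r^{p^c}` at most
`p - 1` times, then it is the choice of the leading terms. By induction on the row `r`, and along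
the row from left to right: higher rows have taken the higher levels on the antidiagonal, and the
boxes to the left in row `r` have used up the lower levels. -/
theorem eq_revPerm_of_card_le (hp : 2 ≤ p) (hreg : IsTRegular p lam)
    (σ : ∀ k : Fin (tconj p lam 0), Equiv.Perm (Fin (antidiagLen p lam k)))
    (hσ : ∀ c r, #{i : Σ k : Fin (tconj p lam 0), Fin (antidiagLen p lam k) |
      (σ i.1 i.2 : ℕ) = c ∧ antidiagStart p lam i.1 + i.2 = r} < p) (k) : σ k = Fin.revPerm := by
  classical
  suffices h : ∀ r k, ∀ hk : k < tconj p lam 0, ∀ j : Fin (antidiagLen p lam k),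
      antidiagStart p lam k + j = r → (σ ⟨k, hk⟩ j : ℕ) = k / (p - 1) - r by
    ext j
    rw [h _ k k.2 j rfl, Fin.revPerm_apply, Fin.val_rev]
    have := antidiagStart_add_len hp hreg k.2
    omega
  intro r
  induction r using Nat.strong_induction_on with
  | _ r ihr =>
  intro k
  induction k using Nat.strong_induction_on with
  | _ k ihk =>
  intro hk j hj
  have hlen := antidiagStart_add_len hp hreg hk
  have hj2 := j.2
  set u : ℕ := (σ ⟨k, hk⟩ j).val with hu
  have hulen : u < antidiagLen p lam k := (σ ⟨k, hk⟩ j).2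
  by_contra hne
  rcases Nat.lt_or_gt_of_ne hne with hlt | hgt
  · -- the level `u` is used up by the boxes of row `r` in the `u`th block of columns
    have hrow := (mem_antidiagRows hp k r).1
      ((mem_antidiagRows_iff hp hreg hk r).2 ⟨by omega, by omega⟩)
    have hblock : ∀ k', k' ∈ Ico ((r + u) * (p - 1)) ((r + u) * (p - 1) + (p - 1)) →
        k' / (p - 1) = r + u ∧ k' < k := by
      intro k' hk'
      rw [Finset.mem_Ico] at hk'
      have h1 : k' / (p - 1) = r + u := by
        rw [Nat.div_eq_iff (by omega)]
        omega
      refine ⟨h1, ?_⟩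
      by_contra hcon
      have := Nat.div_le_div_right (c := p - 1) (Nat.le_of_not_lt hcon)
      omega
    refine absurd (hσ u r) (Nat.not_lt.2 ?_)
    refine le_trans ?_ (Finset.card_image_le (f := fun i => (i.1 : ℕ)))
    have hcard : #(insert k (Ico ((r + u) * (p - 1)) ((r + u) * (p - 1) + (p - 1)))) = p := by
      rw [Finset.card_insert_of_notMem, Nat.card_Ico]
      · omega
      · intro h
        exact lt_irrefl k (hblock k h).2
    refine hcard.symm.le.trans (Finset.card_le_card fun k' hk' => ?_)
    rw [Finset.mem_image]
    rcases Finset.mem_insert.1 hk' with rfl | hk'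
    · exact ⟨⟨⟨k', hk⟩, j⟩, Finset.mem_filter.2 ⟨Finset.mem_univ _, rfl, hj⟩, rfl⟩
    · obtain ⟨hdiv, hlt'⟩ := hblock k' hk'
      have hk'2 : k' < tconj p lam 0 := hlt'.trans hk
      have hr' := (mem_antidiagRows_iff hp hreg hk'2 r).1
        ((mem_antidiagRows hp k' r).2 ⟨by omega, by omega⟩)
      have hlen' := antidiagStart_add_len hp hreg hk'2
      have hadd : antidiagStart p lam k' + (r - antidiagStart p lam k') = r := by omega
      refine ⟨⟨⟨k', hk'2⟩, ⟨r - antidiagStart p lam k', by simp only; omega⟩⟩,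
        Finset.mem_filter.2 ⟨Finset.mem_univ _, ?_, hadd⟩, rfl⟩
      refine (ihk k' hlt' hk'2 ⟨r - antidiagStart p lam k', by omega⟩ hadd).trans ?_
      omega
  · -- the level `u` is taken by a higher row of the same antidiagonal
    obtain ⟨j', hj'⟩ : ∃ j' : Fin (antidiagLen p lam k),
        (j' : ℕ) = antidiagLen p lam k - 1 - u := ⟨⟨_, by omega⟩, rfl⟩
    have h1 := ihr (k / (p - 1) - u) (by omega) k hk j' (by omega)
    have h2 : σ ⟨k, hk⟩ j' = σ ⟨k, hk⟩ j := by
      refine Fin.ext (h1.trans ?_)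
      change _ = u
      omega
    have h3 := congrArg Fin.val ((σ ⟨k, hk⟩).injective h2)
    omega

theorem card_antidiag_level (hp : 2 ≤ p) (hreg : IsTRegular p lam)
    (σ : ∀ k : Fin (tconj p lam 0), Equiv.Perm (Fin (antidiagLen p lam k))) (c : ℕ) :
    #{i : Σ k : Fin (tconj p lam 0), Fin (antidiagLen p lam k) | (σ i.1 i.2 : ℕ) = c} =
      #{b ∈ lam.cells | b.2 / (p - 1) = c} := by
  rw [Finset.card_filter, Finset.card_filter, Fintype.sum_sigma,
    ← sum_antidiag hp hreg (fun _ d => if d = c then 1 else 0), Finset.sum_range]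
  refine Finset.sum_congr rfl fun k _ => ?_
  exact (Equiv.sum_comp (σ k) (fun j => if (j : ℕ) = c then 1 else 0)).trans
    (Equiv.sum_comp Fin.revPerm
      (fun j : Fin (antidiagLen p lam k) => if (j : ℕ) = c then 1 else 0)).symm

/-- A choice of terms of the antidiagonal determinants other than that of the leading terms
does not contribute: it involves a `p`th power of one of the linear forms. -/
theorem coeff_term_eq_zero [Fact p.Prime] (hlen : lam.colLen 0 = n) (hreg : IsTRegular p lam)
    (N : ℕ) (σ : ∀ k : Fin (tconj p lam 0), Equiv.Perm (Fin (antidiagLen p lam k)))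
    (hσ : σ ≠ fun _ => Fin.revPerm) :
    coeff (spikeSeq p n lam.rowLen) (homCoaction p n N
      (∏ k : Fin (tconj p lam 0), ∏ j : Fin (antidiagLen p lam k),
        var p n (antidiagStart p lam k + j) ^ p ^ (σ k j : ℕ))) = 0 := by
  have hp := (Fact.out : p.Prime).two_le
  have h := coeff_spikeSeq hp (C := numBlocks p lam) (K := n) (L := lam.rowLen)
    (fun k _ x hx => numBlocks_spec hp lam hx)
    (univ : Finset (Σ k : Fin (tconj p lam 0), Fin (antidiagLen p lam k)))
    (fun i => σ i.1 i.2)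
    (fun i _ => (σ i.1 i.2).2.trans_le (antidiagLen_le_numBlocks hp hreg i.1.2))
    (fun i => rowForm (powerRow p n (σ i.1 i.2)) N (antidiagStart p lam i.1 + i.2))
    (fun _ _ => rowForm_isHomogeneous _ _ _)
    (fun c => (card_antidiag_level hp hreg σ c).trans (card_cells_filter lam _ c hlen.le))
  rw [← Finset.univ_sigma_univ, Finset.prod_sigma] at h
  simp only [map_prod, map_pow, homCoaction_var, rowForm_pow]
  rw [h]
  have hex : ∃ c r, p ≤ #{i : Σ k : Fin (tconj p lam 0), Fin (antidiagLen p lam k) |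
      (σ i.1 i.2 : ℕ) = c ∧ antidiagStart p lam i.1 + i.2 = r} := by
    by_contra hcon
    push Not at hcon
    exact hσ (funext (eq_revPerm_of_card_le hp hreg σ hcon))
  obtain ⟨c, r, hcr⟩ := hex
  have hc : c ∈ range (numBlocks p lam) := by
    obtain ⟨i, hi⟩ := Finset.card_pos.1 ((show 0 < p by omega).trans_le hcr)
    rw [Finset.mem_range, ← (Finset.mem_filter.1 hi).2.1]
    exact (σ i.1 i.2).2.trans_le (antidiagLen_le_numBlocks hp hreg i.1.2)
  refine Finset.prod_eq_zero hc ?_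
  rw [Finset.prod_congr rfl (g := fun i => rowForm (powerRow p n c) N
    (antidiagStart p lam i.1 + i.2)) fun i hi => by rw [(Finset.mem_filter.1 hi).2]]
  refine coeff_prod_rowForm_eq_zero _ _ _ _ (r := r) ?_ (digitSeq_lt hp _ _ _)
  rw [Finset.filter_filter]
  exact hcr

theorem vPoly_eq_sum (p n : ℕ) (lam : YoungDiagram) : vPoly p n lam =
    ∑ σ : ∀ k : Fin (tconj p lam 0), Equiv.Perm (Fin (antidiagLen p lam k)),
      (∏ k, Equiv.Perm.sign (σ k)) •
        ∏ k : Fin (tconj p lam 0), ∏ j : Fin (antidiagLen p lam k),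
          var p n (antidiagStart p lam k + j) ^ p ^ (σ k j : ℕ) := by
  rw [vPoly, Finset.prod_range]
  simp only [vFactor_eq, vdm_eq_sum]
  rw [Finset.prod_univ_sum, Fintype.piFinset_univ]
  refine Finset.sum_congr rfl fun σ _ => ?_
  rw [Finset.prod_smul]

theorem coeff_vPoly [Fact p.Prime] (hlen : lam.colLen 0 = n) (hreg : IsTRegular p lam) {N : ℕ}
    (hN : n < N) :
    coeff (spikeSeq p n lam.rowLen) (homCoaction p n N (vPoly p n lam)) =
      (epsilon p lam).negOnePow • pPoly p n lam := by
  have hp := (Fact.out : p.Prime).two_le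
  have hsmul : ∀ (u : ℤˣ) (f : MvPolynomial (Fin n) (ZMod p)),
      coeff (spikeSeq p n lam.rowLen) (homCoaction p n N (u • f)) =
        u • coeff (spikeSeq p n lam.rowLen) (homCoaction p n N f) := by
    intro u f
    rw [Units.smul_def, Units.smul_def, map_zsmul, coeff_smul]
  rw [vPoly_eq_sum, map_sum, coeff_sum, Finset.sum_eq_single fun _ => Fin.revPerm]
  · rw [hsmul, ← coeff_boxMonomial hlen hreg hN, ← prod_antidiag_var hreg,
      ← prod_sign_rev hp hreg, Finset.prod_range, Finset.prod_range]
    rfl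
  · intro σ _ hσ
    rw [hsmul, coeff_term_eq_zero hlen hreg N σ hσ, smul_zero]
  · intro h
    exact absurd (Finset.mem_univ _) h

theorem vPoly_isHomogeneous [Fact p.Prime] (hreg : IsTRegular p lam) :
    (vPoly p n lam).IsHomogeneous (∑ b ∈ lam.cells, p ^ (b.2 / (p - 1))) := by
  have hp := (Fact.out : p.Prime).two_le
  rw [← sum_antidiag hp hreg (fun _ c => p ^ c), vPoly]
  refine IsHomogeneous.prod _ _ _ fun k _ => ?_
  have hrev : ∑ j : Fin (antidiagLen p lam k), p ^ (Fin.rev j : ℕ) =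
      ∑ j : Fin (antidiagLen p lam k), p ^ (j : ℕ) :=
    Equiv.sum_comp Fin.revPerm (fun j : Fin (antidiagLen p lam k) => p ^ (j : ℕ))
  rw [hrev]
  exact vdm_isHomogeneous _ _

end VPoly

/-! ### The product of the column determinants -/

section WPoly

theorem det_of_sum {R : Type*} [CommRing R] {s N : ℕ} (b : Fin s → Fin N → R)
    (a : Fin s → Fin s → Fin N → R) :
    Matrix.det (Matrix.of fun i j => ∑ k, b i k * a i j k) =
      ∑ κ : Fin s → Fin N, (∏ i, b i (κ i)) * Matrix.det (Matrix.of fun i j => a i j (κ i)) := by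
  have h := (Matrix.detRowAlternating (R := R) (n := Fin s)).toMultilinearMap.map_sum
    (g := fun i k => b i k • fun j => a i j k)
  have h2 : (fun i => ∑ k, b i k • fun j => a i j k) = fun i j => ∑ k, b i k * a i j k := by
    ext i j
    simp [Finset.sum_apply]
  rw [h2] at h
  refine h.trans (Finset.sum_congr rfl fun κ _ => ?_)
  rw [MultilinearMap.map_smul_univ]
  rfl

variable {p n : ℕ} {lam kap : YoungDiagram}

/-- The determinant with the entry `x_{j+1}^{p^{i + κ i}}` in row `i` and column `j`. -/
noncomputable def shiftedVdm (p n : ℕ) {s N : ℕ} (κ : Fin s → Fin N) :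
    MvPolynomial (Fin n) (ZMod p) :=
  Matrix.det (Matrix.of fun i j : Fin s => powerRow p n i j (κ i))

theorem homCoaction_vdm [Fact p.Prime] (N s : ℕ) : homCoaction p n N (vdm p n 0 s) =
    ∑ κ : Fin s → Fin N, (∏ i : Fin s, expand (p ^ (i : ℕ)) (X (κ i : ℕ))) *
      C (shiftedVdm p n κ) := by
  rw [vdm, AlgHom.map_det]
  have h := det_of_sum
    (fun (i : Fin s) (k : Fin N) => expand (p ^ (i : ℕ)) (X (k : ℕ)))
    (fun (i j : Fin s) (k : Fin N) =>
      (C (powerRow p n i j k) : MvPolynomial ℕ (MvPolynomial (Fin n) (ZMod p))))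
  refine Eq.trans (congrArg Matrix.det (Matrix.ext fun i j => ?_))
    (h.trans (Finset.sum_congr rfl fun κ _ => ?_))
  · simp only [AlgHom.mapMatrix_apply, Matrix.map_apply, Matrix.of_apply, map_pow, zero_add,
      homCoaction_var, rowForm_pow]
    rw [rowForm, map_sum, Finset.sum_range]
    refine Finset.sum_congr rfl fun k _ => ?_
    rw [map_mul, expand_C, mul_comm]
  · rw [shiftedVdm, RingHom.map_det]
    rfl

theorem shiftedVdm_eq_zero {s N : ℕ} (κ : Fin s → Fin N) {i i' : Fin s} (hne : i ≠ i')
    (h : (κ i : ℕ) + i = κ i' + i') : shiftedVdm p n κ = 0 := by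
  refine Matrix.det_zero_of_row_eq hne (funext fun j => ?_)
  simp only [Matrix.of_apply, powerRow, h]

theorem shiftedVdm_const [Fact p.Prime] {s N : ℕ} (κ : Fin s → Fin N) {a : ℕ}
    (h : ∀ i, (κ i : ℕ) = a) : shiftedVdm p n κ = vdm p n 0 s ^ p ^ a := by
  rw [← leadingMinor_powerRow, leadingMinor, shiftedVdm]
  congr 1
  ext i j : 2
  simp only [Matrix.of_apply, powerRow, h, add_comm]

theorem colLen_of_rowLen_eq_mul {q : ℕ} (hq : 0 < q)
    (hmul : ∀ i, lam.rowLen i = q * kap.rowLen i) (j : ℕ) : lam.colLen j = kap.colLen (j / q) := by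
  refine eq_of_forall_lt_iff fun i => ?_
  rw [lt_colLen_iff, lt_colLen_iff, hmul, Nat.div_lt_iff_lt_mul hq, mul_comm]

theorem numBlocks_of_rowLen_eq_mul (hp : 2 ≤ p)
    (hmul : ∀ i, lam.rowLen i = (p - 1) * kap.rowLen i) : numBlocks p lam = kap.rowLen 0 := by
  rw [numBlocks, hmul]
  exact smul_ceilDiv (α := ℕ) (β := ℕ) (by omega) _

theorem tconj_of_rowLen_eq_mul (hp : 2 ≤ p)
    (hmul : ∀ i, lam.rowLen i = (p - 1) * kap.rowLen i) (c : ℕ) :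
    tconj p lam c = (p - 1) * kap.colLen c := by
  rw [tconj_eq_sum hp, colLen_of_rowLen_eq_mul (by omega) hmul]
  simp only [hmul, blockCount_mul (show 0 < p - 1 by omega), ← lt_colLen_iff]
  rw [Nat.zero_div, ← Finset.sum_filter, Finset.sum_const, smul_eq_mul, mul_comm]
  congr 1
  have := kap.colLen_anti 0 c (Nat.zero_le _)
  rw [show {r ∈ range (kap.colLen 0) | r < kap.colLen c} = range (kap.colLen c) by
    ext r
    simp only [Finset.mem_filter, Finset.mem_range]
    omega, Finset.card_range]

/-- The columns of a column `2`-regular partition have distinct lengths. -/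
theorem add_lt_colLen (hcol : ColumnRegular 2 kap) {a k c : ℕ} (hak : a ≤ k)
    (hc : c < kap.colLen k) : c + (k - a) < kap.colLen a := by
  have h : ∀ t, kap.rowLen c ≤ kap.rowLen (c + t) + t := by
    intro t
    induction t with
    | zero => simp
    | succ t ih =>
      have := hcol (c + t)
      rw [show c + (t + 1) = c + t + 1 from rfl]
      omega
  rw [lt_colLen_iff] at hc ⊢
  have := h (k - a)
  omega

/-- A choice `κ` of one term `ξ_k^{p^c} (x_j^{p^{c+k}})_j` from each row `c` of the column
determinants. If no two rows of a determinant coincide, and `ξ_k^{p^c}` is used `q = p - 1` times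
for each `c < κ'_k` and not otherwise, then the determinants of the `a`th block of columns take all
their rows from `k = a`. By induction, from low rows upwards and from left to right: a larger `k`
repeats a lower row of the same determinant, and a smaller `k` is used up by an earlier block. -/
theorem eq_div_of_card_eq {q N : ℕ} (hq : 0 < q) (hcol : ColumnRegular 2 kap)
    (hmul : ∀ i, lam.rowLen i = q * kap.rowLen i)
    (κ : ∀ j : Fin (lam.rowLen 0), Fin (lam.colLen j) → Fin N)
    (hinj : ∀ j i i', i ≠ i' → (κ j i : ℕ) + i ≠ κ j i' + i')
    (hcard : ∀ c k, #{i : Σ j : Fin (lam.rowLen 0), Fin (lam.colLen j) |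
      (i.2 : ℕ) = c ∧ (κ i.1 i.2 : ℕ) = k} = if c < kap.colLen k then q else 0) (j i) :
    (κ j i : ℕ) = j / q := by
  classical
  have hlen := colLen_of_rowLen_eq_mul hq hmul
  suffices h : ∀ d c, kap.colLen 0 - c = d → ∀ j, ∀ hj : j < lam.rowLen 0, ∀ i : Fin (lam.colLen j),
      (i : ℕ) = c → (κ ⟨j, hj⟩ i : ℕ) = j / q from h _ _ rfl j j.2 i rfl
  intro d
  induction d using Nat.strong_induction_on with
  | _ d ihd =>
  intro c hd j
  induction j using Nat.strong_induction_on with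
  | _ j ihj =>
  intro hj i hic
  have hi : c < kap.colLen (j / q) := by
    rw [← hlen, ← hic]
    exact i.2
  obtain ⟨k, hk⟩ : ∃ k, (κ ⟨j, hj⟩ i).val = k := ⟨_, rfl⟩
  rw [hk]
  have hck : c < kap.colLen k := by
    by_contra hcon
    have h0 := hcard c k
    rw [if_neg hcon, Finset.card_eq_zero] at h0
    have hmem : (⟨⟨j, hj⟩, i⟩ : Σ j : Fin (lam.rowLen 0), Fin (lam.colLen j)) ∈
        (∅ : Finset (Σ j : Fin (lam.rowLen 0), Fin (lam.colLen j))) := by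
      rw [← h0]
      exact Finset.mem_filter.2 ⟨Finset.mem_univ _, hic, hk⟩
    exact absurd hmem (Finset.notMem_empty _)
  rcases lt_trichotomy k (j / q) with hlt | heq | hgt
  · exfalso
    have hblock : ∀ j' ∈ Ico (k * q) (k * q + q), j' / q = k ∧ j' < j := by
      intro j' hj'
      rw [Finset.mem_Ico] at hj'
      have h1 : j' / q = k := by
        rw [Nat.div_eq_iff hq]
        omega
      refine ⟨h1, ?_⟩
      by_contra hcon
      have := Nat.div_le_div_right (c := q) (Nat.le_of_not_lt hcon)
      omega
    have h1 : #(insert j (Ico (k * q) (k * q + q))) = q + 1 := by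
      rw [Finset.card_insert_of_notMem, Nat.card_Ico, Nat.add_sub_cancel_left]
      intro h
      exact lt_irrefl j (hblock j h).2
    have h2 := hcard c k
    rw [if_pos hck] at h2
    have h3 : q + 1 ≤ q := by
      refine le_trans ?_ ((Finset.card_image_le (f := fun i => (i.1 : ℕ))).trans h2.le)
      refine h1.symm.le.trans (Finset.card_le_card fun j' hj' => ?_)
      rw [Finset.mem_image]
      rcases Finset.mem_insert.1 hj' with rfl | hj'
      · exact ⟨⟨⟨j', hj⟩, i⟩, Finset.mem_filter.2 ⟨Finset.mem_univ _, hic, hk⟩, rfl⟩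
      · obtain ⟨hdiv, hlt'⟩ := hblock j' hj'
        obtain ⟨i', hi'⟩ : ∃ i' : Fin (lam.colLen j'), (i' : ℕ) = c :=
          ⟨⟨c, by rw [hlen, hdiv]; exact hck⟩, rfl⟩
        refine ⟨⟨⟨j', hlt'.trans hj⟩, i'⟩, Finset.mem_filter.2 ⟨Finset.mem_univ _, hi', ?_⟩, rfl⟩
        exact (ihj j' hlt' (hlt'.trans hj) i' hi').trans hdiv
    omega
  · exact heq
  · exfalso
    have hc' := add_lt_colLen hcol hgt.le hck
    obtain ⟨i', hi'⟩ : ∃ i' : Fin (lam.colLen j), (i' : ℕ) = c + (k - j / q) :=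
      ⟨⟨_, by rw [hlen]; exact hc'⟩, rfl⟩
    have hmono := kap.colLen_anti 0 (j / q) (Nat.zero_le _)
    have h1 := ihd (kap.colLen 0 - (c + (k - j / q))) (by omega) _ rfl j hj i' hi'
    refine hinj ⟨j, hj⟩ i i' ?_ (by omega)
    intro h
    have := congrArg Fin.val h
    omega

theorem sum_blockCount_tconj (hp : 2 ≤ p) (hmul : ∀ i, lam.rowLen i = (p - 1) * kap.rowLen i)
    (c : ℕ) : ∑ k ∈ range (numBlocks p lam), blockCount (p - 1) (tconj p lam k) c =
      lam.rowLen c := by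
  simp only [tconj_of_rowLen_eq_mul hp hmul, blockCount_mul (show 0 < p - 1 by omega),
    lt_colLen_iff]
  rw [numBlocks_of_rowLen_eq_mul hp hmul, ← Finset.sum_filter, Finset.sum_const, smul_eq_mul,
    mul_comm, hmul]
  congr 1
  have := kap.rowLen_anti 0 c (Nat.zero_le _)
  rw [show {r ∈ range (kap.rowLen 0) | r < kap.rowLen c} = range (kap.rowLen c) by
    ext r
    simp only [Finset.mem_filter, Finset.mem_range]
    omega, Finset.card_range]

theorem card_column_filter (lam : YoungDiagram) (c : ℕ) (P : ℕ → Prop) [DecidablePred P] :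
    #{i : Σ j : Fin (lam.rowLen 0), Fin (lam.colLen j) | (i.2 : ℕ) = c ∧ P i.1} =
      #{j ∈ range (lam.rowLen c) | P j} := by
  refine Finset.card_bij (fun i _ => (i.1 : ℕ)) ?_ ?_ ?_
  · rintro ⟨j, i⟩ h
    obtain ⟨-, h1, h2⟩ := Finset.mem_filter.1 h
    refine Finset.mem_filter.2 ⟨Finset.mem_range.2 ?_, h2⟩
    rw [← lt_colLen_iff, ← h1]
    exact i.2
  · rintro ⟨j, i⟩ h ⟨j', i'⟩ h' hjj
    obtain ⟨-, h1, -⟩ := Finset.mem_filter.1 h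
    obtain ⟨-, h1', -⟩ := Finset.mem_filter.1 h'
    obtain rfl : j = j' := Fin.ext hjj
    obtain rfl : i = i' := Fin.ext (h1.trans h1'.symm)
    rfl
  · intro j hj
    obtain ⟨h1, h2⟩ := Finset.mem_filter.1 hj
    rw [Finset.mem_range] at h1
    exact ⟨⟨⟨j, h1.trans_le (lam.rowLen_anti 0 c (Nat.zero_le _))⟩,
      ⟨c, (lt_colLen_iff lam c j).2 h1⟩⟩, Finset.mem_filter.2 ⟨Finset.mem_univ _, rfl, h2⟩, rfl⟩

theorem digitSeq_tconj (hp : 2 ≤ p) (hmul : ∀ i, lam.rowLen i = (p - 1) * kap.rowLen i)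
    (c k : ℕ) : digitSeq p (numBlocks p lam) (tconj p lam) c k =
      if c < kap.colLen k then p - 1 else 0 := by
  rw [digitSeq, sum_single_apply, tconj_of_rowLen_eq_mul hp hmul,
    blockCount_mul (show 0 < p - 1 by omega), numBlocks_of_rowLen_eq_mul hp hmul]
  split_ifs with h1 h2 h2
  · rfl
  · rfl
  · rw [lt_colLen_iff] at h2
    have := kap.rowLen_anti 0 c (Nat.zero_le _)
    omega
  · rfl

theorem coeff_prod_X {A ι : Type*} [CommRing A] (s : Finset ι) (κ : ι → ℕ) (m : ℕ →₀ ℕ)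
    [Decidable (∀ k, #{i ∈ s | κ i = k} = m k)] :
    coeff m (∏ i ∈ s, (X (κ i) : MvPolynomial ℕ A)) =
      if ∀ k, #{i ∈ s | κ i = k} = m k then 1 else 0 := by
  classical
  have h : ∏ i ∈ s, (X (κ i) : MvPolynomial ℕ A) =
      monomial (∑ i ∈ s, Finsupp.single (κ i) 1) 1 := by
    rw [monomial_sum_one]
    rfl
  have h2 : ∑ i ∈ s, Finsupp.single (κ i) 1 = m ↔ ∀ k, #{i ∈ s | κ i = k} = m k := by
    rw [DFunLike.ext_iff]
    refine forall_congr' fun k => ?_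
    rw [Finsupp.finsetSum_apply, Finset.card_filter]
    simp only [Finsupp.single_apply]
  rw [h, coeff_monomial]
  simp only [h2]

theorem homCoaction_wPoly [Fact p.Prime] (N : ℕ) (lam : YoungDiagram) :
    homCoaction p n N (wPoly p n lam) =
      ∑ κ : ∀ j : Fin (lam.rowLen 0), Fin (lam.colLen j) → Fin N,
        (∏ i : Σ j : Fin (lam.rowLen 0), Fin (lam.colLen j),
          expand (p ^ (i.2 : ℕ)) (X (κ i.1 i.2 : ℕ))) * C (∏ j, shiftedVdm p n (κ j)) := by
  rw [wPoly, Finset.prod_range, map_prod]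
  simp only [homCoaction_vdm]
  rw [Finset.prod_univ_sum, Fintype.piFinset_univ]
  refine Finset.sum_congr rfl fun κ _ => ?_
  rw [Finset.prod_mul_distrib, map_prod, ← Finset.univ_sigma_univ, Finset.prod_sigma]

theorem coeff_wPoly_term [Fact p.Prime] (hlen : lam.colLen 0 = n)
    (hmul : ∀ i, lam.rowLen i = (p - 1) * kap.rowLen i)
    {N : ℕ} (κ : ∀ j : Fin (lam.rowLen 0), Fin (lam.colLen j) → Fin N)
    [Decidable (∀ c < n, ∀ k, #{i : Σ j : Fin (lam.rowLen 0), Fin (lam.colLen j) |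
        (i.2 : ℕ) = c ∧ (κ i.1 i.2 : ℕ) = k} = if c < kap.colLen k then p - 1 else 0)] :
    coeff (spikeSeq p (numBlocks p lam) (tconj p lam))
      (∏ i : Σ j : Fin (lam.rowLen 0), Fin (lam.colLen j), expand (p ^ (i.2 : ℕ))
        (X (κ i.1 i.2 : ℕ) : MvPolynomial ℕ (MvPolynomial (Fin n) (ZMod p)))) =
      if ∀ c < n, ∀ k, #{i : Σ j : Fin (lam.rowLen 0), Fin (lam.colLen j) |
        (i.2 : ℕ) = c ∧ (κ i.1 i.2 : ℕ) = k} = if c < kap.colLen k then p - 1 else 0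
      then 1 else 0 := by
  classical
  have hp := (Fact.out : p.Prime).two_le
  have hlen' : kap.colLen 0 = n := by
    rw [← hlen, colLen_of_rowLen_eq_mul (by omega) hmul, Nat.zero_div]
  rw [coeff_spikeSeq hp (C := n) (K := numBlocks p lam) (L := tconj p lam) ?_
    (univ : Finset (Σ j : Fin (lam.rowLen 0), Fin (lam.colLen j))) (fun i => i.2) ?_
    (fun i => X (κ i.1 i.2 : ℕ)) (fun i _ => isHomogeneous_X _ _) ?_]
  · simp only [coeff_prod_X, Finset.filter_filter, digitSeq_tconj hp hmul]
    split_ifs with h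
    · exact Finset.prod_eq_one fun c hc => if_pos (h c (Finset.mem_range.1 hc))
    · push Not at h
      obtain ⟨c, hc, k, hk⟩ := h
      exact Finset.prod_eq_zero (Finset.mem_range.2 hc) (if_neg fun h => hk (h k))
  · intro k _ x hx
    rw [tconj_of_rowLen_eq_mul hp hmul] at hx
    rw [Nat.div_lt_iff_lt_mul (by omega), mul_comm, ← hlen']
    exact hx.trans_le (Nat.mul_le_mul_left _ (kap.colLen_anti 0 k (Nat.zero_le _)))
  · intro i _
    exact i.2.2.trans_le ((lam.colLen_anti 0 _ (Nat.zero_le _)).trans_eq hlen)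
  · intro c
    rw [sum_blockCount_tconj hp hmul]
    simpa using card_column_filter lam c (fun _ => True)

@[to_additive]
theorem prod_range_blocks {M : Type*} [CommMonoid M] (g : ℕ → M) (q m : ℕ) :
    ∏ j ∈ range (q * m), g j = ∏ c ∈ range m, ∏ t ∈ range q, g (c * q + t) := by
  induction m with
  | zero => simp
  | succ m ih => rw [Nat.mul_succ, Finset.prod_range_add, ih, Finset.prod_range_succ, mul_comm q]

theorem mul_add_div_of_lt {q t : ℕ} (c : ℕ) (ht : t < q) : (c * q + t) / q = c := by
  rw [mul_comm, Nat.mul_add_div (by omega), Nat.div_eq_of_lt ht, add_zero]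

theorem pPoly_eq_prod (hp : 2 ≤ p) (n : ℕ)
    (hmul : ∀ i, lam.rowLen i = (p - 1) * kap.rowLen i) :
    pPoly p n lam =
      ∏ j ∈ range (lam.rowLen 0), vdm p n 0 (lam.colLen j) ^ p ^ (j / (p - 1)) := by
  rw [pPoly, numBlocks_of_rowLen_eq_mul hp hmul, hmul, prod_range_blocks]
  refine Finset.prod_congr rfl fun c _ => ?_
  rw [wPoly_block, ← Finset.prod_pow]
  exact Finset.prod_congr rfl fun t ht => by rw [mul_add_div_of_lt c (Finset.mem_range.1 ht)]

theorem coeff_wPoly [Fact p.Prime] (hlen : lam.colLen 0 = n) (hcol : ColumnRegular 2 kap)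
    (hmul : ∀ i, lam.rowLen i = (p - 1) * kap.rowLen i) {N : ℕ} (hN : numBlocks p lam ≤ N) :
    coeff (spikeSeq p (numBlocks p lam) (tconj p lam)) (homCoaction p n N (wPoly p n lam)) =
      pPoly p n lam := by
  classical
  have hp := (Fact.out : p.Prime).two_le
  have hq : 0 < p - 1 := by omega
  have hlen' : kap.colLen 0 = n := by
    rw [← hlen, colLen_of_rowLen_eq_mul (by omega) hmul, Nat.zero_div]
  -- the choice that takes the rows of the `a`th block of columns from `ξ_a`
  set κ₀ : ∀ j : Fin (lam.rowLen 0), Fin (lam.colLen j) → Fin N := fun j _ =>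
    ⟨j / (p - 1), (numBlocks_spec hp lam j.2).trans_le hN⟩ with hκ₀
  rw [homCoaction_wPoly, coeff_sum, Finset.sum_eq_single κ₀]
  · rw [mul_comm, coeff_C_mul, coeff_wPoly_term hlen hmul, if_pos, mul_one, pPoly_eq_prod hp n hmul,
      Finset.prod_range]
    · exact Finset.prod_congr rfl fun j _ => shiftedVdm_const _ fun _ => rfl
    · intro c _ k
      rw [hκ₀]
      refine (card_column_filter lam c (fun j => j / (p - 1) = k)).trans ?_
      refine Eq.trans (b := blockCount (p - 1) (lam.rowLen c) k) rfl ?_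
      rw [hmul, blockCount_mul hq]
      simp only [lt_colLen_iff]
  · intro κ _ hne
    rw [mul_comm, coeff_C_mul, coeff_wPoly_term hlen hmul]
    split_ifs with hcard
    · rw [mul_one]
      by_contra hprod
      refine hne (funext fun j => funext fun i => Fin.ext ?_)
      refine eq_div_of_card_eq hq hcol hmul κ ?_ ?_ j i
      · intro j i i' hii h
        exact hprod (Finset.prod_eq_zero (Finset.mem_univ j) (shiftedVdm_eq_zero _ hii h))
      · intro c k
        rcases Nat.lt_or_ge c n with hc | hc
        · exact hcard c hc k
        · have := kap.colLen_anti 0 k (Nat.zero_le _)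
          rw [if_neg (by omega), Finset.card_eq_zero, Finset.filter_eq_empty_iff]
          rintro ⟨j, i⟩ _ ⟨h, -⟩
          have h1 := i.2
          have h2 := lam.colLen_anti 0 j (Nat.zero_le _)
          simp only at h
          omega
    · rw [mul_zero]
  · intro h
    exact absurd (Finset.mem_univ _) h

theorem wPoly_isHomogeneous (lam : YoungDiagram) : (wPoly p n lam).IsHomogeneous
    (∑ j ∈ range (lam.rowLen 0), ∑ i : Fin (lam.colLen j), p ^ (i : ℕ)) :=
  IsHomogeneous.prod _ _ _ fun _ _ => vdm_isHomogeneous _ _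

theorem degree_spikeSeq (p K : ℕ) (L : ℕ → ℕ) :
    (spikeSeq p K L).degree = ∑ k ∈ range K, spikeExp p (L k) := by
  rw [spikeSeq, map_sum]
  simp only [Finsupp.degree_single]

theorem degree_spikeSeq_rowLen (hp : 2 ≤ p) (hlen : lam.colLen 0 = n) :
    (spikeSeq p n lam.rowLen).degree = ∑ b ∈ lam.cells, p ^ (b.2 / (p - 1)) := by
  rw [degree_spikeSeq, sum_cells lam _ hlen.le]
  simp only [spikeExp_eq_sum hp]

theorem degree_spikeSeq_tconj (hp : 2 ≤ p)
    (hmul : ∀ i, lam.rowLen i = (p - 1) * kap.rowLen i) :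
    (spikeSeq p (numBlocks p lam) (tconj p lam)).degree =
      ∑ j ∈ range (lam.rowLen 0), ∑ i : Fin (lam.colLen j), p ^ (i : ℕ) := by
  rw [degree_spikeSeq, numBlocks_of_rowLen_eq_mul hp hmul, hmul, sum_range_blocks]
  refine Finset.sum_congr rfl fun k _ => ?_
  have h1 : ∀ t ∈ range (p - 1), ∑ i : Fin (lam.colLen (k * (p - 1) + t)), p ^ (i : ℕ) =
      ∑ c ∈ range (kap.colLen k), p ^ c := fun t ht => by
    rw [← Finset.sum_range (fun i => p ^ i), colLen_of_rowLen_eq_mul (by omega) hmul,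
      mul_add_div_of_lt k (Finset.mem_range.1 ht)]
  rw [tconj_of_rowLen_eq_mul hp hmul, spikeExp_eq_sum hp, sum_range_blocks,
    Finset.sum_congr rfl h1, Finset.sum_comm]
  refine Finset.sum_congr rfl fun t ht => Finset.sum_congr rfl fun c _ => ?_
  rw [mul_add_div_of_lt c (Finset.mem_range.1 ht)]

end WPoly

/-! ### Milnor spikes as coefficients of the homogenized coaction -/

section Main

variable {p n : ℕ}

theorem spikeSeq_apply (p K : ℕ) (L : ℕ → ℕ) (k : ℕ) :
    spikeSeq p K L k = if k < K then spikeExp p (L k) else 0 :=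
  sum_single_apply K _ k

theorem toFinsupp_map_spikeExp (p K : ℕ) (L : ℕ → ℕ) :
    (((List.range K).map L).map (spikeExp p)).toFinsupp = spikeSeq p K L := by
  ext k
  rw [List.toFinsupp_apply, spikeSeq_apply]
  split_ifs with h
  · simp [h]
  · simp [h]

theorem toFinsupp_tail_apply (p K : ℕ) (L : ℕ → ℕ) (k : ℕ) :
    (((List.range K).map L).tail.map (spikeExp p)).toFinsupp k = spikeSeq p K L (k + 1) := by
  rw [← toFinsupp_map_spikeExp, List.toFinsupp_apply, List.toFinsupp_apply, List.map_tail,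
    List.getD_eq_getElem?_getD, List.getD_eq_getElem?_getD, List.getElem?_tail]

/-- With the first entry of the sequence taken as the exponent of `ξ_0`. -/
theorem milnorSpike_tail {K N : ℕ} (hK : K ≤ N) (L : ℕ → ℕ) {f : MvPolynomial (Fin n) (ZMod p)}
    (hf : f.IsHomogeneous (spikeSeq p K L).degree) :
    milnorSpike p n ((List.range K).map L).tail f =
      coeff (spikeSeq p K L) (homCoaction p n N f) :=
  milnorP_eq_coeff hf rfl
    (fun k hk => by rw [spikeSeq_apply, if_neg (by omega)])
    (toFinsupp_tail_apply p K L)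

theorem milnorSpike_eq_pow [Fact p.Prime] {K N : ℕ} (hK : K ≤ N) (L : ℕ → ℕ)
    {f : MvPolynomial (Fin n) (ZMod p)} (hf : f.IsHomogeneous (spikeSeq p K L).degree) :
    milnorSpike p n ((List.range K).map L) f =
      coeff (spikeSeq p K L) (homCoaction p n N f) ^ p := by
  rw [milnorSpike, toFinsupp_map_spikeExp]
  exact milnorP_eq_coeff_pow hf rfl (fun k hk => by rw [spikeSeq_apply, if_neg (by omega)])

theorem units_smul_smul {M : Type*} [AddCommGroup M] (u : ℤˣ) (f : M) : u • u • f = f := by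
  rw [smul_smul, Int.units_mul_self, one_smul]

theorem units_smul_pow_odd {R : Type*} [CommRing R] (u : ℤˣ) (f : R) {k : ℕ} (hk : Odd k) :
    (u • f) ^ k = u • f ^ k := by
  rcases Int.units_eq_one_or u with rfl | rfl
  · simp
  · simp [hk.neg_pow]

end Main

end MilnorSpike

open MilnorSpike in
theorem mainTheorem7 (p : ℕ) [Fact p.Prime] (hp : Odd p) (n : ℕ) (hn : 0 < n)
    (lam : YoungDiagram) (hlen : lam.colLen 0 = n) (hreg : IsTRegular p lam) :
    -- (i): the Milnor spike associated to `(λ_2, …, λ_n)`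
    (milnorSpike p n lam.rowLens.tail (sPoly p n lam) = pPoly p n lam ∧
      (epsilon p lam).negOnePow • milnorSpike p n lam.rowLens.tail (vPoly p n lam)
        = pPoly p n lam) ∧
    -- (ii): the Milnor spike associated to `(γ_2, …, γ_m)`
    (∀ kap : YoungDiagram, ColumnRegular 2 kap →
      (∀ i, lam.rowLen i = (p - 1) * kap.rowLen i) →
      milnorSpike p n (tconjList p lam).tail (wPoly p n lam) = pPoly p n lam) ∧
    -- (iii): the Milnor spikes associated to `λ` and to `γ`
    (milnorSpike p n lam.rowLens (sPoly p n lam) = pPoly p n lam ^ p ∧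
      (epsilon p lam).negOnePow • milnorSpike p n lam.rowLens (vPoly p n lam)
        = pPoly p n lam ^ p) ∧
    (∀ kap : YoungDiagram, ColumnRegular 2 kap →
      (∀ i, lam.rowLen i = (p - 1) * kap.rowLen i) →
      milnorSpike p n (tconjList p lam) (wPoly p n lam) = pPoly p n lam ^ p) := by
  have hp2 := (Fact.out : p.Prime).two_le
  have hrow : lam.rowLens = (List.range n).map lam.rowLen := by rw [← hlen]; rfl
  have hdeg := degree_spikeSeq_rowLen hp2 hlen
  have hs : (boxMonomial p n lam).IsHomogeneous (spikeSeq p n lam.rowLen).degree :=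
    hdeg ▸ boxMonomial_isHomogeneous lam
  have hv : (vPoly p n lam).IsHomogeneous (spikeSeq p n lam.rowLen).degree :=
    hdeg ▸ vPoly_isHomogeneous hreg
  have hw : ∀ kap : YoungDiagram, (∀ i, lam.rowLen i = (p - 1) * kap.rowLen i) →
      (wPoly p n lam).IsHomogeneous (spikeSeq p (numBlocks p lam) (tconj p lam)).degree :=
    fun kap hmul => degree_spikeSeq_tconj hp2 hmul ▸ wPoly_isHomogeneous lam
  have hN : n < n + 1 := Nat.lt_succ_self n
  rw [sPoly_eq_boxMonomial hlen hreg, hrow, tconjList]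
  refine ⟨⟨?_, ?_⟩, fun kap hcol hmul => ?_, ⟨?_, ?_⟩, fun kap hcol hmul => ?_⟩
  · rw [milnorSpike_tail hN.le _ hs, coeff_boxMonomial hlen hreg hN]
  · rw [milnorSpike_tail hN.le _ hv, coeff_vPoly hlen hreg hN, units_smul_smul]
  · rw [milnorSpike_tail le_rfl _ (hw kap hmul), coeff_wPoly hlen hcol hmul le_rfl]
  · rw [milnorSpike_eq_pow hN.le _ hs, coeff_boxMonomial hlen hreg hN]
  · rw [milnorSpike_eq_pow hN.le _ hv, coeff_vPoly hlen hreg hN, units_smul_pow_odd _ _ hp,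
      units_smul_smul]
  · rw [milnorSpike_eq_pow le_rfl _ (hw kap hmul), coeff_wPoly hlen hcol hmul le_rfl]
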